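/- Let $k\ge 2$, let $\mathbb F_k$ be the free group on generators $g_1,\dots,g_k$, and let $VN(\mathbb F_k)$ be its group von Neumann algebra, i.e. the von Neumann algebra generated by the left regular representation on $\ell^2(\mathbb F_k)$, with normalized trace $\mathrm{tr}(x)=\langle x\delta_e,\delta_e\rangle$ and norm $\|x\|_2=\mathrm{tr}(x^*x)^{1/2}$. Let $\mathcal B\subseteq VN(\mathbb F_k)$ be the Laplacian (radial) masa, i.e. the abelian von Neumann subalgebra generated by $w_1=\sum_{i=1}^k(g_i+g_i^{-1})$, and let $\mathbb E_{\mathcal B}$ be the (unique) trace preserving conditional expectation of $VN(\mathbb F_k)$ onto $\mathcal B$. Then $\mathbb E_{\mathcal B}$ is an asymptotic homomorphism: there is a unitary $u\in\mathcal B$ such that $$\lim_{|n|\to\infty}\bigl\|\mathbb E_{\mathcal B}(xu^ny)-\mathbb E_{\mathcal B}(x)\,\mathbb E_{\mathcal B}(y)\,u^n\bigr\|_2=0\qquad(n\in\mathbb Z)$$ for all $x,y\in VN(\mathbb F_k)$. -/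

import Mathlib

open Filter Topology

noncomputable section

/-- The Hilbert space `ℓ²(G)` of square summable complex functions on a (discrete) group. -/
abbrev EllTwo (G : Type*) := lp (fun _ : G => ℂ) 2

/-- The point mass `δ_e` at the identity of `G`, a unit vector of `ℓ²(G)`. -/
def deltaOne (G : Type*) [Group G] : EllTwo G := by
  classical exact lp.single 2 (1 : G) (1 : ℂ)

lemma memℓp_comp_equiv {G : Type*} (e : G ≃ G) (f : EllTwo G) :
    Memℓp (fun h : G => f (e h)) 2 := by
  have h2 : (0 : ℝ) < (2 : ENNReal).toReal := by norm_num
  exact memℓp_gen (e.summable_iff.mpr ((lp.memℓp f).summable h2))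

/-- The left regular representation `λ : G → B(ℓ²(G))`, `(λ(g) f)(h) = f(g⁻¹ h)`;
it sends the basis vector `δ_h` to `δ_{g h}`. -/
def leftRegular {G : Type*} [Group G] (g : G) : EllTwo G →L[ℂ] EllTwo G :=
  LinearMap.mkContinuous
    { toFun := fun f => ⟨fun h => f (g⁻¹ * h), memℓp_comp_equiv (Equiv.mulLeft g⁻¹) f⟩
      map_add' := fun _ _ => rfl
      map_smul' := fun _ _ => rfl } 1 (by
    intro f
    have h2 : (0 : ℝ) < (2 : ENNReal).toReal := by norm_num
    rw [one_mul, lp.norm_eq_tsum_rpow h2, lp.norm_eq_tsum_rpow h2]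
    exact le_of_eq (congrArg (· ^ (1 / (2 : ENNReal).toReal))
      ((Equiv.mulLeft g⁻¹).tsum_eq fun h => ‖f h‖ ^ (2 : ENNReal).toReal)))

@[simp]
lemma leftRegular_apply {G : Type*} [Group G] (g : G) (f : EllTwo G) (h : G) :
    leftRegular g f h = f (g⁻¹ * h) := rfl

/-- The von Neumann algebra generated by a set `S` of operators on a Hilbert space: the double
commutant `(S ∪ S*)''`. (`StarSubalgebra.centralizer ℂ S` is the commutant of `S ∪ S*`.) -/
def vonNeumannGenerated {H : Type*} [NormedAddCommGroup H] [InnerProductSpace ℂ H]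
    [CompleteSpace H] (S : Set (H →L[ℂ] H)) : VonNeumannAlgebra H where
  toStarSubalgebra :=
    StarSubalgebra.centralizer ℂ (StarSubalgebra.centralizer ℂ S : Set (H →L[ℂ] H))
  centralizer_centralizer' := by
    change Set.centralizer (Set.centralizer
      ((StarSubalgebra.centralizer ℂ (StarSubalgebra.centralizer ℂ S : Set (H →L[ℂ] H)) :
        StarSubalgebra ℂ (H →L[ℂ] H)) : Set (H →L[ℂ] H))) =
      ((StarSubalgebra.centralizer ℂ (StarSubalgebra.centralizer ℂ S : Set (H →L[ℂ] H)) :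
        StarSubalgebra ℂ (H →L[ℂ] H)) : Set (H →L[ℂ] H))
    rw [StarSubalgebra.coe_centralizer_centralizer, Set.centralizer_centralizer_centralizer]

lemma coe_vonNeumannGenerated {H : Type*} [NormedAddCommGroup H] [InnerProductSpace ℂ H]
    [CompleteSpace H] (S : Set (H →L[ℂ] H)) :
    (vonNeumannGenerated S : Set (H →L[ℂ] H)) = (S ∪ star S).centralizer.centralizer :=
  StarSubalgebra.coe_centralizer_centralizer ℂ S

/-- The group von Neumann algebra `VN(G)`, generated by the left regular representation. -/
def groupVN (G : Type*) [Group G] : VonNeumannAlgebra (EllTwo G) :=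
  vonNeumannGenerated (Set.range (leftRegular : G → EllTwo G →L[ℂ] EllTwo G))

/-- `VN(G)` as a complex `*`-algebra (a star subalgebra of `B(ℓ²(G))`). -/
abbrev GroupVN (G : Type*) [Group G] := (groupVN G).toStarSubalgebra

/-- The canonical trace `tr(x) = ⟨x δ_e, δ_e⟩` (Mathlib's inner product is conjugate linear in its
first argument). On `VN(G)` it is the normalized trace. -/
def groupTrace {G : Type*} [Group G] (x : EllTwo G →L[ℂ] EllTwo G) : ℂ :=
  inner ℂ (deltaOne G) (x (deltaOne G))

/-- The trace norm `‖x‖₂ = tr(x* x)^{1/2}`. -/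
def normTwo {G : Type*} [Group G] (x : EllTwo G →L[ℂ] EllTwo G) : ℝ :=
  Real.sqrt (groupTrace (star x * x)).re

/-- `E` is the trace preserving conditional expectation of `VN(G)` onto its von Neumann
subalgebra `N`, regarded as a map of `VN(G)` into itself with range `N`: a positive `N`-bimodular
linear projection onto `N` that preserves the trace. -/
structure IsTraceCondExp {G : Type*} [Group G] (N : VonNeumannAlgebra (EllTwo G))
    (E : GroupVN G →ₗ[ℂ] GroupVN G) : Prop where
  le : N ≤ groupVN G
  mem : ∀ x : GroupVN G, (E x : EllTwo G →L[ℂ] EllTwo G) ∈ N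
  map_of_mem : ∀ b : GroupVN G, (b : EllTwo G →L[ℂ] EllTwo G) ∈ N → E b = b
  bimodule : ∀ b x c : GroupVN G, (b : EllTwo G →L[ℂ] EllTwo G) ∈ N →
    (c : EllTwo G →L[ℂ] EllTwo G) ∈ N → E (b * x * c) = b * E x * c
  positive : ∀ x : GroupVN G, (x : EllTwo G →L[ℂ] EllTwo G).IsPositive →
    (E x : EllTwo G →L[ℂ] EllTwo G).IsPositive
  trace : ∀ x : GroupVN G,
    groupTrace (E x : EllTwo G →L[ℂ] EllTwo G) = groupTrace (x : EllTwo G →L[ℂ] EllTwo G)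

/-- The conditional expectation `E` onto the von Neumann subalgebra `N` of `VN(G)` is an
asymptotic homomorphism: `N` is abelian and there is one unitary `u ∈ N` such that
`‖E(x uⁿ y) - E(x) E(y) uⁿ‖₂ → 0` as `|n| → ∞`, `n ∈ ℤ`, for all `x, y ∈ VN(G)`. -/
def IsAsymptoticHom {G : Type*} [Group G] (N : VonNeumannAlgebra (EllTwo G))
    (E : GroupVN G →ₗ[ℂ] GroupVN G) : Prop :=
  (∀ a ∈ N, ∀ b ∈ N, a * b = b * a) ∧
  ∃ u : unitary (GroupVN G), ((u : GroupVN G) : EllTwo G →L[ℂ] EllTwo G) ∈ N ∧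
    ∀ x y : GroupVN G,
      Tendsto (fun n : ℤ =>
          normTwo ((E (x * ((u ^ n : unitary (GroupVN G)) : GroupVN G) * y)
            - E x * E y * ((u ^ n : unitary (GroupVN G)) : GroupVN G) : GroupVN G) :
              EllTwo G →L[ℂ] EllTwo G))
        (comap (fun n : ℤ => |n|) atTop) (𝓝 0)

/-- `w₁ = ∑ᵢ (gᵢ + gᵢ⁻¹)`, the sum over the free generators of the free group `𝔽_k`. -/
def freeLaplacian (k : ℕ) : EllTwo (FreeGroup (Fin k)) →L[ℂ] EllTwo (FreeGroup (Fin k)) :=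
  ∑ i : Fin k, (leftRegular (FreeGroup.of i) + leftRegular ((FreeGroup.of i)⁻¹))

/-- The Laplacian (radial) subalgebra of `VN(𝔽_k)`: the von Neumann algebra generated by `w₁`. -/
def laplacianAlgebra (k : ℕ) : VonNeumannAlgebra (EllTwo (FreeGroup (Fin k))) :=
  vonNeumannGenerated {freeLaplacian k}

end

/-! Write `P` for the projection of ℓ² onto L²(B), the closure of `B δ_e`, let `χₙ` be the indicator
of the sphere `Sₙ`, and take `u = exp(i w₁)`. Bimodularity and commutativity of `B` turn the defect
into a single term, `E(x uⁿ y) - E(x) E(y) uⁿ = E((x - E x) uⁿ y)`. For `x = λ(g)` and `y = λ(h)`,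
evaluation at `δ_e` gives `T (uⁿ δ_e)` with `T = P (λ(g) - E λ(g)) ρ(h⁻¹)`. The limit then follows
from two facts.

`T` is small on radial vectors. Here `E λ(g)` is the average of `λ(g')` over `|g'| = |g|`, and
`⟨χ_l, λ(g) ρ(h⁻¹) χₙ⟩` counts the words `w` of length `n` with `|g w h| = l`. Up to an error
bounded uniformly in `n` and `l`, this count depends on `g` only through `|g|`
(`exists_sphereSum_sub_le`). As `∑ |S_l|^{-1/2}` converges, `‖T χₙ‖` is bounded although `‖χₙ‖ =
|Sₙ|^{1/2}` grows exponentially. Hence the norms of `T` on the orthonormal basis `χₙ/‖χₙ‖` are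
summable, and `T` sends bounded weakly null families of radial vectors to norm null ones
(`tendsto_apply_of_radial`).

The vectors `exp(i s w₁) δ_e` are weakly null as `|s| → ∞`: the spectral distribution of `w₁` (the
Kesten measure) is absolutely continuous, so the Riemann–Lebesgue lemma applies
(`tendsto_inner_sphereVec_exp`).

General `x` and `y` are reached by approximation in the 2-norm, one variable at a time. The
expectation itself is constructed for any abelian `N ≤ VN(G)`: the compression of `x` to L²(N)
commutes with `N`, and such an operator is represented by an element of `N'' = N`. -/

noncomputable section

/-! ### Standard form of VN(G): right translations, the conjugation `J`, and the trace vector. -/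

section GroupVN

variable {G : Type*} [Group G]

lemma deltaOne_apply [inst : DecidableEq G] (h : G) :
    deltaOne G h = if h = 1 then 1 else 0 := by
  obtain rfl : inst = fun a b => Classical.propDecidable (a = b) := Subsingleton.elim _ _
  let _ : DecidableEq G := fun a b => Classical.propDecidable (a = b)
  exact (lp.single_apply ..).trans (Pi.single_apply ..)

/-- The right regular representation, `(ρ(g) f)(h) = f(h g)`. -/
def rightRegular (g : G) : EllTwo G →L[ℂ] EllTwo G :=
  LinearMap.mkContinuous
    { toFun := fun f => ⟨fun h => f (h * g), memℓp_comp_equiv (Equiv.mulRight g) f⟩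
      map_add' := fun _ _ => rfl
      map_smul' := fun _ _ => rfl } 1 (by
    intro f
    have h2 : (0 : ℝ) < (2 : ENNReal).toReal := by norm_num
    rw [one_mul, lp.norm_eq_tsum_rpow h2, lp.norm_eq_tsum_rpow h2]
    exact le_of_eq (congrArg (· ^ (1 / (2 : ENNReal).toReal))
      ((Equiv.mulRight g).tsum_eq fun h => ‖f h‖ ^ (2 : ENNReal).toReal)))

@[simp]
lemma rightRegular_apply (g : G) (f : EllTwo G) (h : G) :
    rightRegular g f h = f (h * g) := rfl

lemma rightRegular_mul_leftRegular (g h : G) :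
    rightRegular g * leftRegular h = leftRegular h * rightRegular g := by
  ext f x
  simp [mul_assoc]

lemma leftRegular_one : leftRegular (1 : G) = 1 := by
  ext f x; simp

lemma leftRegular_mul (g h : G) : leftRegular (g * h) = leftRegular g * leftRegular h := by
  ext f x; simp [mul_assoc]

lemma star_leftRegular (g : G) : star (leftRegular g) = leftRegular g⁻¹ := by
  rw [ContinuousLinearMap.star_eq_adjoint]
  symm
  rw [ContinuousLinearMap.eq_adjoint_iff]
  intro x y
  rw [lp.inner_eq_tsum, lp.inner_eq_tsum,
    ← (Equiv.mulLeft g).tsum_eq fun h => inner ℂ (x h) (leftRegular g y h)]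
  simp

lemma star_rightRegular (g : G) : star (rightRegular g) = rightRegular g⁻¹ := by
  rw [ContinuousLinearMap.star_eq_adjoint]
  symm
  rw [ContinuousLinearMap.eq_adjoint_iff]
  intro x y
  rw [lp.inner_eq_tsum, lp.inner_eq_tsum,
    ← (Equiv.mulRight g).tsum_eq fun h => inner ℂ (rightRegular g⁻¹ x h) (y h)]
  simp

lemma leftRegular_deltaOne_apply [DecidableEq G] (g h : G) :
    leftRegular g (deltaOne G) h = if h = g then 1 else 0 := by
  simp [deltaOne_apply, inv_mul_eq_one, eq_comm]

lemma rightRegular_deltaOne (g : G) :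
    rightRegular g (deltaOne G) = leftRegular g⁻¹ (deltaOne G) := by
  classical
  ext h
  rw [rightRegular_apply, leftRegular_deltaOne_apply, deltaOne_apply]
  simp only [mul_eq_one_iff_eq_inv]

lemma inner_leftRegular_deltaOne (g : G) (f : EllTwo G) :
    inner ℂ (leftRegular g (deltaOne G)) f = f g := by
  classical
  rw [lp.inner_eq_tsum, tsum_eq_single g]
  · simp [deltaOne_apply]
  · intro h hh
    simp only [leftRegular_deltaOne_apply]
    simp [hh]

/-- Vectors orthogonal to all translates of `δ_e` vanish, so the translates span. -/
lemma dense_span_leftRegular :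
    (Submodule.span ℂ (Set.range fun g : G => leftRegular g (deltaOne G))).topologicalClosure = ⊤ := by
  rw [Submodule.topologicalClosure_eq_top_iff, Submodule.eq_bot_iff]
  intro f hf
  ext g
  rw [← inner_leftRegular_deltaOne]
  exact (Submodule.mem_orthogonal _ _).mp hf _ (Submodule.subset_span ⟨g, rfl⟩)

/-- The canonical conjugation `(J f)(h) = conj (f h⁻¹)` of `ℓ²(G)`. -/
def conjInv : EllTwo G →L⋆[ℂ] EllTwo G :=
  LinearMap.mkContinuous
    { toFun := fun f => ⟨fun h => starRingEnd ℂ (f h⁻¹), by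
        have h2 : (0 : ℝ) < (2 : ENNReal).toReal := by norm_num
        refine memℓp_gen ?_
        simpa using (memℓp_comp_equiv (Equiv.inv G) f).summable h2⟩
      map_add' := fun _ _ => by ext; exact map_add (starRingEnd ℂ) _ _
      map_smul' := fun _ _ => by ext; exact map_mul (starRingEnd ℂ) _ _ } 1 (by
    intro f
    have h2 : (0 : ℝ) < (2 : ENNReal).toReal := by norm_num
    rw [one_mul, lp.norm_eq_tsum_rpow h2, lp.norm_eq_tsum_rpow h2]
    refine le_of_eq (congrArg (· ^ (1 / (2 : ENNReal).toReal)) ?_)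
    rw [← (Equiv.inv G).tsum_eq fun h => ‖f h‖ ^ (2 : ENNReal).toReal]
    simp)

@[simp]
lemma conjInv_apply (f : EllTwo G) (h : G) : conjInv f h = starRingEnd ℂ (f h⁻¹) := rfl

@[simp]
lemma conjInv_conjInv (f : EllTwo G) : conjInv (conjInv f) = f := by
  ext; simp

lemma conjInv_deltaOne : conjInv (deltaOne G) = deltaOne G := by
  classical
  ext h
  simp only [conjInv_apply, deltaOne_apply, inv_eq_one]
  split_ifs <;> simp

lemma inner_conjInv (f g : EllTwo G) : inner ℂ (conjInv f) g = inner ℂ (conjInv g) f := by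
  rw [lp.inner_eq_tsum, lp.inner_eq_tsum, ← (Equiv.inv G).tsum_eq]
  simp [mul_comm]

lemma conjInv_leftRegular (g : G) (f : EllTwo G) :
    conjInv (leftRegular g f) = rightRegular g (conjInv f) := by
  ext h; simp

/-- `J y J`, which is right multiplication by `y*` when `y ∈ VN(G)`. -/
def conjOp (y : EllTwo G →L[ℂ] EllTwo G) : EllTwo G →L[ℂ] EllTwo G :=
  conjInv.comp (y.comp conjInv)

@[simp]
lemma conjOp_apply (y : EllTwo G →L[ℂ] EllTwo G) (f : EllTwo G) :
    conjOp y f = conjInv (y (conjInv f)) := rfl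

lemma star_conjOp (y : EllTwo G →L[ℂ] EllTwo G) : star (conjOp y) = conjOp (star y) := by
  rw [ContinuousLinearMap.star_eq_adjoint]
  symm
  rw [ContinuousLinearMap.eq_adjoint_iff]
  intro f g
  rw [conjOp_apply, inner_conjInv, ContinuousLinearMap.star_eq_adjoint,
    ContinuousLinearMap.adjoint_inner_right, conjOp_apply, ← inner_conj_symm, inner_conjInv,
    inner_conj_symm]

/-- The set of left translations is closed under adjoints, so the star operation drops out of the
double commutant. -/
lemma mem_groupVN_iff {x : EllTwo G →L[ℂ] EllTwo G} :
    x ∈ groupVN G ↔ ∀ m : EllTwo G →L[ℂ] EllTwo G,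
      (∀ g : G, leftRegular g * m = m * leftRegular g) → m * x = x * m := by
  have h := coe_vonNeumannGenerated (Set.range (leftRegular : G → EllTwo G →L[ℂ] EllTwo G))
  have hs : star (Set.range (leftRegular : G → EllTwo G →L[ℂ] EllTwo G)) =
      Set.range (leftRegular : G → EllTwo G →L[ℂ] EllTwo G) := by
    ext y
    constructor
    · rintro ⟨g, hg⟩
      exact ⟨g⁻¹, by rw [← star_leftRegular, hg, star_star]⟩
    · rintro ⟨g, rfl⟩
      exact ⟨g⁻¹, by rw [star_leftRegular]⟩
  rw [hs, Set.union_self] at h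
  rw [← SetLike.mem_coe, groupVN, h, Set.mem_centralizer_iff]
  simp [Set.mem_centralizer_iff]

lemma leftRegular_mem_groupVN (g : G) : leftRegular g ∈ groupVN G :=
  mem_groupVN_iff.mpr fun _ hm => (hm g).symm

lemma rightRegular_comm {x : EllTwo G →L[ℂ] EllTwo G} (hx : x ∈ groupVN G) (g : G) :
    rightRegular g * x = x * rightRegular g :=
  mem_groupVN_iff.mp hx _ fun h => (rightRegular_mul_leftRegular g h).symm

lemma rightRegular_apply_comm {x : EllTwo G →L[ℂ] EllTwo G} (hx : x ∈ groupVN G) (g : G)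
    (f : EllTwo G) : rightRegular g (x f) = x (rightRegular g f) :=
  congrArg (fun T => T f) (rightRegular_comm hx g)

/-- `J` exchanges left and right translations and `y` commutes with the right ones, so `J y J`
commutes with every `λ(g)` and therefore with `λ(G)''`. -/
lemma conjOp_comm {x y : EllTwo G →L[ℂ] EllTwo G} (hx : x ∈ groupVN G) (hy : y ∈ groupVN G) :
    conjOp y * x = x * conjOp y := by
  refine mem_groupVN_iff.mp hx _ fun g => ?_
  ext1 f
  have h1 : ∀ f : EllTwo G, leftRegular g (conjInv f) = conjInv (rightRegular g f) := fun f => by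
    ext h; simp
  have h2 : conjInv (leftRegular g f) = rightRegular g (conjInv f) := conjInv_leftRegular g f
  change leftRegular g (conjInv (y (conjInv f))) = conjInv (y (conjInv (leftRegular g f)))
  rw [h1, h2, rightRegular_apply_comm hy]

/-- `J` is the closure of `x δ_e ↦ x* δ_e`. The coordinates are compared one at a time by moving a
right translation through `x`. -/
lemma conjInv_apply_deltaOne {x : EllTwo G →L[ℂ] EllTwo G} (hx : x ∈ groupVN G) :
    conjInv (x (deltaOne G)) = star x (deltaOne G) := by
  ext g
  have h := rightRegular_deltaOne (G := G) g⁻¹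
  rw [inv_inv] at h
  calc _ = inner ℂ (x (deltaOne G)) (rightRegular g (deltaOne G)) := by
        rw [conjInv_apply, ← inner_leftRegular_deltaOne, inner_conj_symm, rightRegular_deltaOne]
    _ = inner ℂ (star (rightRegular g) (x (deltaOne G))) (deltaOne G) := by
        rw [ContinuousLinearMap.star_eq_adjoint, ContinuousLinearMap.adjoint_inner_left]
    _ = inner ℂ (x (leftRegular g (deltaOne G))) (deltaOne G) := by
        rw [star_rightRegular, rightRegular_apply_comm hx, h]
    _ = _ := by
        rw [← inner_leftRegular_deltaOne g, ContinuousLinearMap.star_eq_adjoint,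
          ContinuousLinearMap.adjoint_inner_right]

/-- `δ_e` is a separating vector for `VN(G)`. -/
lemma eq_of_apply_deltaOne {x y : EllTwo G →L[ℂ] EllTwo G} (hx : x ∈ groupVN G)
    (hy : y ∈ groupVN G) (h : x (deltaOne G) = y (deltaOne G)) : x = y := by
  refine ContinuousLinearMap.ext_on (Submodule.dense_iff_topologicalClosure_eq_top.mpr
    dense_span_leftRegular) ?_
  rintro _ ⟨g, rfl⟩
  have h1 := rightRegular_deltaOne (G := G) g⁻¹
  rw [inv_inv] at h1
  simp only [← h1, ← rightRegular_apply_comm hx, ← rightRegular_apply_comm hy, h]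

lemma conjOp_deltaOne {y : EllTwo G →L[ℂ] EllTwo G} (hy : y ∈ groupVN G) :
    conjOp y (deltaOne G) = star y (deltaOne G) := by
  rw [conjOp_apply, conjInv_deltaOne, conjInv_apply_deltaOne hy]

lemma normTwo_eq (x : EllTwo G →L[ℂ] EllTwo G) : normTwo x = ‖x (deltaOne G)‖ := by
  rw [normTwo, groupTrace, mul_apply_eq_comp, ContinuousLinearMap.star_eq_adjoint,
    ContinuousLinearMap.adjoint_inner_right, inner_self_eq_norm_sq_to_K]
  norm_cast
  exact Real.sqrt_sq (norm_nonneg _)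

lemma norm_conjInv (f : EllTwo G) : ‖conjInv f‖ = ‖f‖ := by
  have h : ∀ f : EllTwo G, ‖conjInv f‖ ≤ ‖f‖ := fun f => by
    simpa using (conjInv (G := G)).le_of_opNorm_le
      (LinearMap.mkContinuous_norm_le _ zero_le_one _) f
  exact le_antisymm (h f) (by simpa using h (conjInv f))

/-- The trace property in the form `‖a y‖₂ ≤ ‖a‖₂ ‖y‖`. -/
lemma norm_mul_deltaOne_le {a y : EllTwo G →L[ℂ] EllTwo G} (ha : a ∈ groupVN G)
    (hy : y ∈ groupVN G) : ‖a (y (deltaOne G))‖ ≤ ‖a (deltaOne G)‖ * ‖y‖ := by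
  -- This is `a y = (y* a*)*` at `δ_e`; adjoints become the isometry `J`, and `y*` now acts last,
  -- where its operator norm applies.
  have h : a (y (deltaOne G)) = conjInv (star y (conjInv (a (deltaOne G)))) := by
    have h1 := conjInv_apply_deltaOne (star_mem (mul_mem ha hy))
    rw [star_star, star_mul] at h1
    rw [conjInv_apply_deltaOne ha]
    exact h1.symm
  rw [h, norm_conjInv, mul_comm]
  calc _ ≤ ‖star y‖ * ‖conjInv (a (deltaOne G))‖ := ContinuousLinearMap.le_opNorm _ _
    _ = _ := by rw [norm_conjInv, norm_star y]

end GroupVN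

/-! ### The conditional expectation onto an abelian von Neumann subalgebra. -/

section CondExp

lemma starProjection_comm {H : Type*} [NormedAddCommGroup H] [InnerProductSpace ℂ H]
    [CompleteSpace H] (U : Submodule ℂ H) [U.HasOrthogonalProjection] {y : H →L[ℂ] H}
    (h : ∀ f ∈ U, y f ∈ U) (h' : ∀ f ∈ U, star y f ∈ U) :
    U.starProjection * y = y * U.starProjection := by
  ext f
  refine Submodule.eq_starProjection_of_mem_of_inner_eq_zero
    (h _ (Submodule.starProjection_apply_mem U f)) fun w hw => ?_
  change inner ℂ (y f - y (U.starProjection f)) w = 0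
  rw [← map_sub, ← ContinuousLinearMap.adjoint_inner_right]
  exact Submodule.starProjection_inner_eq_zero f _ (h' w hw)

lemma ContinuousLinearMap.IsPositive.mul_of_commute {H : Type*} [NormedAddCommGroup H]
    [InnerProductSpace ℂ H] [CompleteSpace H] {S T : H →L[ℂ] H} (hS : S.IsPositive)
    (hT : T.IsPositive) (h : S * T = T * S) : (S * T).IsPositive := by
  rw [← ContinuousLinearMap.nonneg_iff_isPositive] at *
  exact Commute.mul_nonneg hS hT h

/-- `m* m` and `‖T‖² - T* T` are commuting positive operators, so their product is positive; its
quadratic form at `f` is `‖T‖² ‖m f‖² - ‖m T f‖²`. -/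
lemma norm_apply_commute_le {H : Type*} [NormedAddCommGroup H]
    [InnerProductSpace ℂ H] [CompleteSpace H] {m T : H →L[ℂ] H}
    (h : (star m * m) * T = T * (star m * m)) (f : H) :
    ‖m (T f)‖ ≤ ‖T‖ * ‖m f‖ := by
  have h' : (star m * m) * star T = star T * (star m * m) := by
    have := congrArg star h
    simpa only [star_mul, star_star] using this.symm
  have hT0 : 0 ≤ algebraMap ℝ (H →L[ℂ] H) (‖T‖ ^ 2) - star T * T :=
    sub_nonneg.mpr CStarAlgebra.star_mul_le_algebraMap_norm_sq
  have hpos := Commute.mul_nonneg (star_mul_self_nonneg m) hT0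
    (.sub_right (Algebra.commutes _ _).symm (.mul_right h' h))
  have h2 := ((ContinuousLinearMap.nonneg_iff_isPositive _).mp hpos).re_inner_nonneg_right f
  have e1 : star m * m * (star T * T) = star (m * T) * (m * T) := by
    rw [← mul_assoc, h', star_mul]; simp only [mul_assoc]
  have e2 : ∀ y : H →L[ℂ] H, RCLike.re (inner ℂ f ((star y * y) f)) = ‖y f‖ ^ 2 := fun y => by
    rw [mul_apply_eq_comp, ContinuousLinearMap.star_eq_adjoint,
      ContinuousLinearMap.adjoint_inner_right, ← norm_sq_eq_re_inner]
  rw [mul_sub, e1, ← Algebra.commutes, ← Algebra.smul_def, sub_apply, inner_sub_right, map_sub,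
    e2] at h2
  have e3 : RCLike.re (inner ℂ f ((‖T‖ ^ 2 • (star m * m)) f)) = ‖T‖ ^ 2 * ‖m f‖ ^ 2 := by
    rw [← e2 m]
    change RCLike.re (inner ℂ f (‖T‖ ^ 2 • ((star m * m) f))) = _
    rw [inner_smul_right_eq_smul, Complex.real_smul]
    exact Complex.re_ofReal_mul _ _
  rw [e3, ← mul_pow, sub_nonneg] at h2
  exact le_of_sq_le_sq h2 (by positivity)

variable {G : Type*} [Group G]

/-- The closure `L²(N)` of `N δ_e` in `ℓ²(G)`. -/
abbrev deltaSpace (N : VonNeumannAlgebra (EllTwo G)) : Submodule ℂ (EllTwo G) :=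
  (Submodule.map (ContinuousLinearMap.apply ℂ (EllTwo G) (deltaOne G)).toLinearMap
    N.toStarSubalgebra.toSubalgebra.toSubmodule).topologicalClosure

/-- The projection of `ℓ²(G)` onto `L²(N)`. -/
def deltaProj (N : VonNeumannAlgebra (EllTwo G)) : EllTwo G →L[ℂ] EllTwo G :=
  (deltaSpace N).starProjection

variable {N : VonNeumannAlgebra (EllTwo G)}

lemma apply_deltaOne_mem {a : EllTwo G →L[ℂ] EllTwo G} (ha : a ∈ N) :
    a (deltaOne G) ∈ deltaSpace N :=
  Submodule.le_topologicalClosure _ ⟨a, ha, rfl⟩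

lemma deltaOne_mem : deltaOne G ∈ deltaSpace N :=
  apply_deltaOne_mem (one_mem N)

lemma deltaSpace_induction {p : EllTwo G → Prop} (hp : IsClosed {f | p f})
    (h : ∀ a ∈ N, p (a (deltaOne G))) {f : EllTwo G} (hf : f ∈ deltaSpace N) : p f := by
  refine hp.closure_subset_iff.mpr ?_ hf
  rintro _ ⟨a, ha, rfl⟩
  exact h a ha

lemma apply_mem_deltaSpace {a : EllTwo G →L[ℂ] EllTwo G} (ha : a ∈ N) {f : EllTwo G}
    (hf : f ∈ deltaSpace N) : a f ∈ deltaSpace N := by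
  refine deltaSpace_induction (N := N) (p := fun f => a f ∈ deltaSpace N)
    ((Submodule.isClosed_topologicalClosure _).preimage a.continuous) (fun c hc => ?_) hf
  exact apply_deltaOne_mem (mul_mem ha hc)

lemma deltaProj_mem (f : EllTwo G) : deltaProj N f ∈ deltaSpace N :=
  Submodule.starProjection_apply_mem _ f

lemma deltaProj_eq_self {f : EllTwo G} (hf : f ∈ deltaSpace N) : deltaProj N f = f :=
  Submodule.starProjection_eq_self_iff.mpr hf

lemma deltaProj_deltaOne : deltaProj N (deltaOne G) = deltaOne G :=
  deltaProj_eq_self deltaOne_mem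

lemma star_deltaProj : star (deltaProj N) = deltaProj N := by
  rw [ContinuousLinearMap.star_eq_adjoint]
  symm
  rw [ContinuousLinearMap.eq_adjoint_iff]
  exact Submodule.inner_starProjection_left_eq_right _

lemma deltaProj_mul_self : deltaProj N * deltaProj N = deltaProj N := by
  ext1 f
  exact deltaProj_eq_self (deltaProj_mem f)

lemma norm_deltaProj_apply_le (f : EllTwo G) : ‖deltaProj N f‖ ≤ ‖f‖ :=
  Submodule.norm_starProjection_apply_le _ f

lemma deltaProj_eq_of_inner {f g : EllTwo G} (hg : g ∈ deltaSpace N)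
    (h : ∀ a ∈ N, inner ℂ (a (deltaOne G)) g = inner ℂ (a (deltaOne G)) f) :
    deltaProj N f = g := by
  refine Submodule.eq_starProjection_of_mem_of_inner_eq_zero hg fun w hw => ?_
  refine deltaSpace_induction (N := N) (p := fun w => inner ℂ (f - g) w = 0)
    (isClosed_eq (by fun_prop) continuous_const) (fun a ha => ?_) hw
  rw [← inner_conj_symm, inner_sub_right, h a ha, sub_self, map_zero]

lemma deltaProj_comm {a : EllTwo G →L[ℂ] EllTwo G} (ha : a ∈ N) :
    deltaProj N * a = a * deltaProj N :=
  starProjection_comm _ (fun _ => apply_mem_deltaSpace ha)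
    fun _ => apply_mem_deltaSpace (star_mem ha)

lemma deltaProj_mem_commutant : deltaProj N ∈ N.commutant :=
  VonNeumannAlgebra.mem_commutant_iff.mpr fun _ ha => (deltaProj_comm ha).symm

lemma conjInv_mem_deltaSpace (hN : N ≤ groupVN G) {f : EllTwo G} (hf : f ∈ deltaSpace N) :
    conjInv f ∈ deltaSpace N := by
  refine deltaSpace_induction (N := N) (p := fun f => conjInv f ∈ deltaSpace N)
    ((Submodule.isClosed_topologicalClosure _).preimage conjInv.continuous) (fun c hc => ?_) hf
  rw [conjInv_apply_deltaOne (hN hc)]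
  exact apply_deltaOne_mem (star_mem hc)

/-- On `N δ_e` right multiplication by `a` agrees with left multiplication because `N` is abelian.
This lets the action of `a` on L²(N) be moved past every `x ∈ VN(G)`. -/
lemma conjOp_apply_of_mem (hN : N ≤ groupVN G) (hab : ∀ a ∈ N, ∀ b ∈ N, a * b = b * a)
    {a : EllTwo G →L[ℂ] EllTwo G} (ha : a ∈ N) {f : EllTwo G} (hf : f ∈ deltaSpace N) :
    conjOp (star a) f = a f := by
  refine deltaSpace_induction (N := N) (p := fun f => conjOp (star a) f = a f)
    (isClosed_eq (conjOp (star a)).continuous a.continuous) (fun c hc => ?_) hf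
  have h := congrArg (fun T => T (deltaOne G)) (conjOp_comm (hN hc) (hN (star_mem ha)))
  simp only [mul_apply_eq_comp] at h
  rw [h, conjOp_deltaOne (hN (star_mem ha)), star_star, ← mul_apply_eq_comp, hab c hc a ha,
    mul_apply_eq_comp]

lemma deltaProj_conjOp_comm (hN : N ≤ groupVN G) (hab : ∀ a ∈ N, ∀ b ∈ N, a * b = b * a)
    {a : EllTwo G →L[ℂ] EllTwo G} (ha : a ∈ N) :
    deltaProj N * conjOp (star a) = conjOp (star a) * deltaProj N := by
  refine starProjection_comm _ (fun f hf => ?_) fun f hf => ?_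
  · rw [conjOp_apply_of_mem hN hab ha hf]
    exact apply_mem_deltaSpace ha hf
  · rw [star_conjOp, conjOp_apply_of_mem hN hab (star_mem ha) hf]
    exact apply_mem_deltaSpace (star_mem ha) hf

/-- The compression of `x ∈ VN(G)` to `L²(N)` commutes with `N`. -/
lemma compression_mem_commutant (hN : N ≤ groupVN G) (hab : ∀ a ∈ N, ∀ b ∈ N, a * b = b * a)
    {x : EllTwo G →L[ℂ] EllTwo G} (hx : x ∈ groupVN G) :
    deltaProj N * x * deltaProj N ∈ N.commutant := by
  refine VonNeumannAlgebra.mem_commutant_iff.mpr fun a ha => ?_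
  have hR : a * deltaProj N = conjOp (star a) * deltaProj N := by
    ext1 f
    exact (conjOp_apply_of_mem hN hab ha (deltaProj_mem f)).symm
  calc a * (deltaProj N * x * deltaProj N) = conjOp (star a) * deltaProj N * x * deltaProj N := by
        rw [← hR]; simp only [mul_assoc]
    _ = deltaProj N * (conjOp (star a) * x) * deltaProj N := by
        rw [← deltaProj_conjOp_comm hN hab ha]; simp only [mul_assoc]
    _ = deltaProj N * x * (conjOp (star a) * deltaProj N) := by
        rw [conjOp_comm hx (hN (star_mem ha))]; simp only [mul_assoc]
    _ = deltaProj N * x * deltaProj N * a := by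
        rw [← hR, ← deltaProj_comm ha]; simp only [mul_assoc]

/-- For `f = c δ_e` and `g = d δ_e` the pairing is `tr(c d b*)`, symmetric in `c` and `d` since `N`
is abelian; the general case follows by continuity. -/
lemma inner_conjInv_of_mem (hN : N ≤ groupVN G) (hab : ∀ a ∈ N, ∀ b ∈ N, a * b = b * a)
    {b : EllTwo G →L[ℂ] EllTwo G} (hb : b ∈ N) {f g : EllTwo G} (hf : f ∈ deltaSpace N)
    (hg : g ∈ deltaSpace N) : inner ℂ (b (conjInv f)) g = inner ℂ (b (conjInv g)) f := by
  refine deltaSpace_induction (N := N)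
    (p := fun f => inner ℂ (b (conjInv f)) g = inner ℂ (b (conjInv g)) f)
    (isClosed_eq (by fun_prop) (by fun_prop)) (fun c hc => ?_) hf
  refine deltaSpace_induction (N := N) (p := fun g => inner ℂ (b (conjInv (c (deltaOne G)))) g =
    inner ℂ (b (conjInv g)) (c (deltaOne G)))
    (isClosed_eq (by fun_prop) (by fun_prop)) (fun d hd => ?_) hg
  have key : ∀ c ∈ N, ∀ d ∈ N, inner ℂ (b (conjInv (c (deltaOne G)))) (d (deltaOne G)) =
      inner ℂ (deltaOne G) ((c * d * star b) (deltaOne G)) := fun c hc d hd => by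
    have h : c * d * star b = star (b * star c) * d := by
      rw [star_mul, star_star, mul_assoc, mul_assoc, hab d hd _ (star_mem hb)]
    rw [h, conjInv_apply_deltaOne (hN hc), mul_apply_eq_comp,
      ContinuousLinearMap.star_eq_adjoint (b * star c), ContinuousLinearMap.adjoint_inner_right]
    rfl
  rw [key c hc d hd, key d hd c hc, hab c hc d hd]

/-- Both vectors lie in L²(N), so testing against `a δ_e` with `a ∈ N` suffices, and there `X`
commutes with `a`. -/
lemma conjInv_commutant_deltaOne (hN : N ≤ groupVN G)
    {X : EllTwo G →L[ℂ] EllTwo G} (hX : X ∈ N.commutant) (hXP : deltaProj N * X = X)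
    (hPX : X * deltaProj N = X) :
    conjInv (X (deltaOne G)) = star X (deltaOne G) := by
  have hXs : deltaProj N * star X = star X := by
    have := congrArg star hPX
    rwa [star_mul, star_deltaProj] at this
  have h1 : X (deltaOne G) ∈ deltaSpace N := by
    rw [← hXP]; exact deltaProj_mem _
  rw [← deltaProj_eq_self (N := N) (conjInv_mem_deltaSpace hN h1)]
  refine deltaProj_eq_of_inner (by rw [← hXs]; exact deltaProj_mem _) fun a ha => ?_
  have hc := VonNeumannAlgebra.mem_commutant_iff.mp hX a ha
  symm
  calc inner ℂ (a (deltaOne G)) (conjInv (X (deltaOne G)))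
      = inner ℂ (X (deltaOne G)) (star a (deltaOne G)) := by
        rw [← inner_conj_symm, inner_conjInv, inner_conj_symm, conjInv_apply_deltaOne (hN ha)]
    _ = inner ℂ ((a * X) (deltaOne G)) (deltaOne G) := by
        rw [ContinuousLinearMap.star_eq_adjoint, ContinuousLinearMap.adjoint_inner_right]; rfl
    _ = _ := by
        rw [hc, ContinuousLinearMap.star_eq_adjoint, ContinuousLinearMap.adjoint_inner_right]; rfl

lemma eq_of_inner_deltaSpace {f g : EllTwo G} (hf : f ∈ deltaSpace N) (hg : g ∈ deltaSpace N)
    (h : ∀ a ∈ N, inner ℂ (a (deltaOne G)) f = inner ℂ (a (deltaOne G)) g) : f = g := by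
  rw [← deltaProj_eq_self hf, deltaProj_eq_of_inner hg fun a ha => (h a ha).symm]

/-- An abelian algebra with a cyclic vector has an abelian commutant. -/
lemma commutant_compression_comm (hN : N ≤ groupVN G) (hab : ∀ a ∈ N, ∀ b ∈ N, a * b = b * a)
    {X Y : EllTwo G →L[ℂ] EllTwo G} (hX : X ∈ N.commutant) (hY : Y ∈ N.commutant)
    (hPX : deltaProj N * X = X) (hXP : X * deltaProj N = X) (hPY : deltaProj N * Y = Y)
    (hYP : Y * deltaProj N = Y) : X * Y = Y * X := by
  have mem : ∀ Z : EllTwo G →L[ℂ] EllTwo G, deltaProj N * Z = Z → ∀ f, Z f ∈ deltaSpace N :=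
    fun Z hZ f => by rw [← hZ]; exact deltaProj_mem _
  have key : ∀ X ∈ N.commutant, ∀ Y : EllTwo G →L[ℂ] EllTwo G, deltaProj N * X = X →
      X * deltaProj N = X → ∀ b ∈ N, inner ℂ (b (deltaOne G)) (X (Y (deltaOne G))) =
      inner ℂ (b (conjInv (X (deltaOne G)))) (Y (deltaOne G)) := fun X hX Y hPX hXP b hb => by
    rw [conjInv_commutant_deltaOne hN hX hPX hXP, ← ContinuousLinearMap.adjoint_inner_left,
      ← ContinuousLinearMap.star_eq_adjoint, ← mul_apply_eq_comp, ← mul_apply_eq_comp,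
      VonNeumannAlgebra.mem_commutant_iff.mp (star_mem hX) b hb]
  -- Against `b δ_e`, both sides become the symmetric pairing of `X δ_e` and `Y δ_e`. Commuting with
  -- `N` then carries the equality from `δ_e` to all of L²(N).
  have h1 : X (Y (deltaOne G)) = Y (X (deltaOne G)) := by
    refine eq_of_inner_deltaSpace (mem X hPX _) (mem Y hPY _) fun b hb => ?_
    rw [key X hX Y hPX hXP b hb, key Y hY X hPY hYP b hb,
      inner_conjInv_of_mem hN hab hb (mem X hPX _) (mem Y hPY _)]
  have h2 : ∀ f ∈ deltaSpace N, X (Y f) = Y (X f) := fun f hf => by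
    refine deltaSpace_induction (N := N) (p := fun f => X (Y f) = Y (X f))
      (isClosed_eq (by fun_prop) (by fun_prop)) (fun a ha => ?_) hf
    have hXa : ∀ f, X (a f) = a (X f) := fun f =>
      congrArg (fun T => T f) (VonNeumannAlgebra.mem_commutant_iff.mp hX a ha).symm
    have hYa : ∀ f, Y (a f) = a (Y f) := fun f =>
      congrArg (fun T => T f) (VonNeumannAlgebra.mem_commutant_iff.mp hY a ha).symm
    rw [hYa, hXa, hXa, hYa, h1]
  calc X * Y = X * (Y * deltaProj N) := by rw [hYP]
    _ = Y * (X * deltaProj N) := by ext1 f; exact h2 _ (deltaProj_mem f)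
    _ = Y * X := by rw [hXP]

lemma compression_props (x : EllTwo G →L[ℂ] EllTwo G) :
    deltaProj N * (deltaProj N * x * deltaProj N) = deltaProj N * x * deltaProj N ∧
    deltaProj N * x * deltaProj N * deltaProj N = deltaProj N * x * deltaProj N := by
  constructor
  · rw [← mul_assoc, ← mul_assoc, deltaProj_mul_self]
  · rw [mul_assoc, deltaProj_mul_self]

/-- The commutant of `N` contains all right translations, which already move `δ_e` onto every point
mass. -/
lemma dense_commutant_deltaOne (hN : N ≤ groupVN G)
    (K : Submodule ℂ (EllTwo G)) (h : ∀ m ∈ N.commutant, m (deltaOne G) ∈ K) :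
    K.topologicalClosure = ⊤ := by
  rw [eq_top_iff, ← dense_span_leftRegular]
  refine Submodule.topologicalClosure_mono (Submodule.span_le.mpr ?_)
  rintro _ ⟨g, rfl⟩
  have h1 := rightRegular_deltaOne (G := G) g⁻¹
  rw [inv_inv] at h1
  change leftRegular g (deltaOne G) ∈ K
  rw [← h1]
  exact h _ (VonNeumannAlgebra.mem_commutant_iff.mpr fun a ha => (rightRegular_comm (hN ha) _).symm)

lemma compression_mem_commutant_of_mem {X : EllTwo G →L[ℂ] EllTwo G} (hX : X ∈ N.commutant) :
    deltaProj N * X * deltaProj N ∈ N.commutant :=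
  mul_mem (mul_mem deltaProj_mem_commutant hX) deltaProj_mem_commutant

lemma star_mul_self_compression (m : EllTwo G →L[ℂ] EllTwo G) :
    star (m * deltaProj N) * (m * deltaProj N) = deltaProj N * (star m * m) * deltaProj N := by
  rw [star_mul, star_deltaProj]; simp only [mul_assoc]

lemma norm_commutant_apply_le (hN : N ≤ groupVN G) (hab : ∀ a ∈ N, ∀ b ∈ N, a * b = b * a)
    {T m : EllTwo G →L[ℂ] EllTwo G} (hT : T ∈ N.commutant) (hPT : deltaProj N * T = T)
    (hTP : T * deltaProj N = T) (hm : m ∈ N.commutant) :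
    ‖m (T (deltaOne G))‖ ≤ ‖T‖ * ‖m (deltaOne G)‖ := by
  obtain ⟨hS1, hS2⟩ := compression_props (N := N) (star m * m)
  have h := norm_apply_commute_le (m := m * deltaProj N) (T := T) (by
    rw [star_mul_self_compression]
    exact commutant_compression_comm hN hab
      (compression_mem_commutant_of_mem (mul_mem (star_mem hm) hm)) hT hS1 hS2 hPT hTP)
    (deltaOne G)
  rw [mul_apply_eq_comp, mul_apply_eq_comp, deltaProj_deltaOne, ← mul_apply_eq_comp (deltaProj N),
    hPT] at h
  exact h

/-- Every vector `T δ_e` with `T` in the compressed commutant is represented by an element of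
the abelian algebra `N`. -/
lemma exists_mem_apply_deltaOne (hN : N ≤ groupVN G) (hab : ∀ a ∈ N, ∀ b ∈ N, a * b = b * a)
    {T : EllTwo G →L[ℂ] EllTwo G} (hT : T ∈ N.commutant) (hPT : deltaProj N * T = T)
    (hTP : T * deltaProj N = T) :
    ∃ b ∈ N, ∀ m ∈ N.commutant, b (m (deltaOne G)) = m (T (deltaOne G)) := by
  let D := N.commutant.toStarSubalgebra.toSubalgebra.toSubmodule
  let e : D →ₗ[ℂ] EllTwo G :=
    (ContinuousLinearMap.apply ℂ (EllTwo G) (deltaOne G)).toLinearMap.comp D.subtype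
  let f : D →ₗ[ℂ] EllTwo G :=
    (ContinuousLinearMap.apply ℂ (EllTwo G) (T (deltaOne G))).toLinearMap.comp D.subtype
  have hd : DenseRange e := by
    have := dense_commutant_deltaOne hN (LinearMap.range e) fun m hm => ⟨⟨m, hm⟩, rfl⟩
    rwa [← Submodule.dense_iff_topologicalClosure_eq_top] at this
  have hb : ∃ C, ∀ x, ‖f x‖ ≤ C * ‖e x‖ :=
    ⟨‖T‖, fun x => norm_commutant_apply_le hN hab hT hPT hTP x.2⟩
  have he : ∀ m ∈ N.commutant, (f.extendOfNorm e) (m (deltaOne G)) = m (T (deltaOne G)) :=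
    fun m hm => LinearMap.extendOfNorm_eq hd hb ⟨m, hm⟩
  -- The map `m δ_e ↦ m T δ_e` is well defined and bounded on a dense subspace. Its extension
  -- commutes with `N'`, hence lies in `N'' = N`.
  refine ⟨f.extendOfNorm e, ?_, he⟩
  rw [← VonNeumannAlgebra.commutant_commutant N, VonNeumannAlgebra.mem_commutant_iff]
  intro m' hm'
  ext1 g
  refine hd.induction_on (p := fun g => (m' * f.extendOfNorm e) g = (f.extendOfNorm e * m') g) g
    (isClosed_eq (ContinuousLinearMap.continuous _) (ContinuousLinearMap.continuous _)) ?_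
  rintro ⟨m, hm⟩
  change m' (f.extendOfNorm e (m (deltaOne G))) = f.extendOfNorm e ((m' * m) (deltaOne G))
  rw [he m hm, he _ (mul_mem hm' hm)]
  rfl

/-- The trace preserving conditional expectation is the projection onto `L²(N)`. -/
lemma exists_condExp (hN : N ≤ groupVN G) (hab : ∀ a ∈ N, ∀ b ∈ N, a * b = b * a)
    {x : EllTwo G →L[ℂ] EllTwo G} (hx : x ∈ groupVN G) :
    ∃ b ∈ N, b (deltaOne G) = deltaProj N (x (deltaOne G)) := by
  obtain ⟨h1, h2⟩ := compression_props (N := N) x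
  obtain ⟨b, hb, h⟩ := exists_mem_apply_deltaOne hN hab (compression_mem_commutant hN hab hx) h1 h2
  refine ⟨b, hb, ?_⟩
  simpa [deltaProj_deltaOne] using h 1 (one_mem _)

/-- Positivity passes to the element of `N` representing the compression of a positive operator. -/
lemma isPositive_of_apply_deltaOne (hN : N ≤ groupVN G) (hab : ∀ a ∈ N, ∀ b ∈ N, a * b = b * a)
    {x b : EllTwo G →L[ℂ] EllTwo G} (hx : x ∈ groupVN G) (hxp : x.IsPositive) (hb : b ∈ N)
    (h : b (deltaOne G) = deltaProj N (x (deltaOne G))) : b.IsPositive := by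
  set T := deltaProj N * x * deltaProj N with hTdef
  obtain ⟨h1, h2⟩ := compression_props (N := N) x
  have hT := compression_mem_commutant hN hab hx
  have hTpos : T.IsPositive := by
    have := hxp.conj_adjoint (deltaProj N)
    rw [← ContinuousLinearMap.star_eq_adjoint, star_deltaProj] at this
    exact this
  have hd := dense_commutant_deltaOne hN
    (Submodule.map (ContinuousLinearMap.apply ℂ (EllTwo G) (deltaOne G)).toLinearMap
    N.commutant.toStarSubalgebra.toSubalgebra.toSubmodule) fun m hm => ⟨m, hm, rfl⟩
  rw [← Submodule.dense_iff_topologicalClosure_eq_top] at hd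
  rw [ContinuousLinearMap.isPositive_iff_complex]
  intro f
  refine hd.induction (P := fun f => ((inner ℂ (b f) f).re : ℂ) = inner ℂ (b f) f ∧
    0 ≤ (inner ℂ (b f) f).re) ?_ ?_ f
  · rintro _ ⟨m, hm, rfl⟩
    change ((inner ℂ (b (m (deltaOne G))) (m (deltaOne G))).re : ℂ) =
      inner ℂ (b (m (deltaOne G))) (m (deltaOne G)) ∧
      0 ≤ (inner ℂ (b (m (deltaOne G))) (m (deltaOne G))).re
    obtain ⟨hS1, hS2⟩ := compression_props (N := N) (star m * m)
    have hS : (star (m * deltaProj N) * (m * deltaProj N)).IsPositive :=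
      (ContinuousLinearMap.nonneg_iff_isPositive _).mp (star_mul_self_nonneg _)
    have hpos := hS.mul_of_commute hTpos (by
      rw [star_mul_self_compression]
      exact commutant_compression_comm hN hab
        (compression_mem_commutant_of_mem (mul_mem (star_mem hm) hm)) hT hS1 hS2 h1 h2)
    -- The form of `b` at `m δ_e` is that of `(P m* m P) T` at `δ_e`, a product of commuting
    -- positive operators.
    have e : inner ℂ (b (m (deltaOne G))) (m (deltaOne G)) =
        inner ℂ ((star (m * deltaProj N) * (m * deltaProj N) * T) (deltaOne G)) (deltaOne G) := by
      rw [mul_assoc, mul_apply_eq_comp, ContinuousLinearMap.star_eq_adjoint,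
        ContinuousLinearMap.adjoint_inner_left, mul_assoc, h1]
      simp only [mul_apply_eq_comp, deltaProj_deltaOne]
      rw [← h]
      have := congrArg (fun T => T (deltaOne G)) (VonNeumannAlgebra.mem_commutant_iff.mp hm b hb)
      simp only [mul_apply_eq_comp] at this
      rw [this]
    rw [e]
    exact (ContinuousLinearMap.isPositive_iff_complex _).mp hpos (deltaOne G)
  · have hc : Continuous fun f => inner ℂ (b f) f := by fun_prop
    exact (isClosed_eq (Complex.continuous_ofReal.comp (Complex.continuous_re.comp hc)) hc).inter
      (isClosed_le continuous_const (Complex.continuous_re.comp hc))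

/-- Bimodularity and trace preservation give `tr(a* E(x)) = tr(a* x)` for `a ∈ N`, which says that
`E(x) δ_e` is the orthogonal projection. Uniqueness follows, as `δ_e` is separating. -/
lemma IsTraceCondExp.apply_deltaOne {E : GroupVN G →ₗ[ℂ] GroupVN G} (hE : IsTraceCondExp N E)
    (x : GroupVN G) :
    (E x : EllTwo G →L[ℂ] EllTwo G) (deltaOne G) =
      deltaProj N ((x : EllTwo G →L[ℂ] EllTwo G) (deltaOne G)) := by
  refine (deltaProj_eq_of_inner (apply_deltaOne_mem (hE.mem x)) fun a ha => ?_).symm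
  let b : GroupVN G := ⟨star a, hE.le (star_mem ha)⟩
  have hb : (b : EllTwo G →L[ℂ] EllTwo G) ∈ N := star_mem ha
  have h1 := hE.bimodule b x 1 hb (one_mem N)
  rw [mul_one, mul_one] at h1
  have h2 := hE.trace (b * x)
  rw [h1] at h2
  simp only [groupTrace] at h2
  change inner ℂ (deltaOne G) (star a ((E x : EllTwo G →L[ℂ] EllTwo G) (deltaOne G))) =
    inner ℂ (deltaOne G) (star a ((x : EllTwo G →L[ℂ] EllTwo G) (deltaOne G))) at h2
  rwa [ContinuousLinearMap.star_eq_adjoint, ContinuousLinearMap.adjoint_inner_right,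
    ContinuousLinearMap.adjoint_inner_right] at h2

lemma IsTraceCondExp.unique {E F : GroupVN G →ₗ[ℂ] GroupVN G} (hE : IsTraceCondExp N E)
    (hF : IsTraceCondExp N F) : E = F := by
  ext1 x
  exact Subtype.ext (eq_of_apply_deltaOne (E x).2 (F x).2
    (by rw [hE.apply_deltaOne, hF.apply_deltaOne]))

/-- Existence of the trace preserving conditional expectation onto an abelian subalgebra. -/
theorem exists_isTraceCondExp (hN : N ≤ groupVN G) (hab : ∀ a ∈ N, ∀ b ∈ N, a * b = b * a) :
    ∃ E : GroupVN G →ₗ[ℂ] GroupVN G, IsTraceCondExp N E := by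
  choose e he heδ using fun x : GroupVN G => exists_condExp hN hab x.2
  have ext : ∀ {a b : GroupVN G}, (a : EllTwo G →L[ℂ] EllTwo G) (deltaOne G) =
      (b : EllTwo G →L[ℂ] EllTwo G) (deltaOne G) → a = b := fun {a b} h =>
    Subtype.ext (eq_of_apply_deltaOne a.2 b.2 h)
  let E : GroupVN G →ₗ[ℂ] GroupVN G :=
    { toFun := fun x => ⟨e x, hN (he x)⟩
      map_add' := fun x y => ext (by
        change e (x + y) (deltaOne G) = e x (deltaOne G) + e y (deltaOne G)
        rw [heδ, heδ, heδ, ← map_add]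
        rfl)
      map_smul' := fun c x => ext (by
        change e (c • x) (deltaOne G) = c • e x (deltaOne G)
        rw [heδ, heδ, ← map_smul]
        rfl) }
  refine ⟨E, hN, he, fun b hb => ext ?_, fun b x c hb hc => ext ?_, fun x hx => ?_, fun x => ?_⟩
  · change e b (deltaOne G) = _
    rw [heδ, deltaProj_eq_self (apply_deltaOne_mem hb)]
  -- Right multiplication by `c` is an operator commuting with the projection, just as left
  -- multiplication by `b` is.
  · have hR : ∀ y ∈ groupVN G, y ((c : EllTwo G →L[ℂ] EllTwo G) (deltaOne G)) =
        conjOp (star (c : EllTwo G →L[ℂ] EllTwo G)) (y (deltaOne G)) := fun y hy => by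
      have h := congrArg (fun T => T (deltaOne G)) (conjOp_comm hy (hN (star_mem hc)))
      simp only [mul_apply_eq_comp] at h
      rw [h, conjOp_deltaOne (hN (star_mem hc)), star_star]
    have hb' : ∀ f, deltaProj N ((b : EllTwo G →L[ℂ] EllTwo G) f) =
        (b : EllTwo G →L[ℂ] EllTwo G) (deltaProj N f) := fun f =>
      congrArg (fun T => T f) (deltaProj_comm hb)
    have hc' : ∀ f, deltaProj N (conjOp (star (c : EllTwo G →L[ℂ] EllTwo G)) f) =
        conjOp (star (c : EllTwo G →L[ℂ] EllTwo G)) (deltaProj N f) := fun f =>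
      congrArg (fun T => T f) (deltaProj_conjOp_comm hN hab hc)
    change e (b * x * c) (deltaOne G) = (b : EllTwo G →L[ℂ] EllTwo G)
      (e x ((c : EllTwo G →L[ℂ] EllTwo G) (deltaOne G)))
    rw [heδ, hR _ (hN (he x)), heδ, ← hc', ← hb', ← hR _ x.2]
    rfl
  · exact isPositive_of_apply_deltaOne hN hab x.2 hx (he x) (heδ x)
  · change inner ℂ (deltaOne G) (e x (deltaOne G)) = inner ℂ (deltaOne G) _
    rw [heδ]
    exact (Submodule.inner_starProjection_left_eq_right (deltaSpace N) _ _).symm.trans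
      (by rw [Submodule.starProjection_eq_self_iff.mpr deltaOne_mem])

end CondExp

/-! ### Counting words in the free group. -/

namespace FreeGroup

section Letters

variable {α : Type*}

/-- A generator or the inverse of a generator, as an element of the free group. -/
def letter (x : α × Bool) : FreeGroup α := mk [x]

/-- The inverse letter. -/
def invLetter (x : α × Bool) : α × Bool := (x.1, !x.2)

@[simp] lemma invLetter_invLetter (x : α × Bool) : invLetter (invLetter x) = x := by simp [invLetter]

@[simp] lemma letter_invLetter (x : α × Bool) : letter (invLetter x) = (letter x)⁻¹ := by
  simp [letter, invLetter, inv_mk, invRev]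

end Letters

variable {α : Type*} [DecidableEq α]

/-- The reduced word of `v` begins with the letter `x`. -/
def StartsWith (x : α × Bool) (v : FreeGroup α) : Prop := v.toWord.head? = some x

instance (x : α × Bool) (v : FreeGroup α) : Decidable (StartsWith x v) :=
  inferInstanceAs (Decidable (_ = _))

lemma startsWith_iff {x : α × Bool} {v : FreeGroup α} :
    StartsWith x v ↔ ∃ l, v.toWord = x :: l := by
  rw [StartsWith, List.head?_eq_some_iff]

lemma StartsWith.eq {x y : α × Bool} {v : FreeGroup α} (hx : StartsWith x v)
    (hy : StartsWith y v) : x = y :=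
  Option.some_injective _ (hx.symm.trans hy)

lemma toWord_mk_of_isReduced {L : List (α × Bool)} (h : IsReduced L) : (mk L).toWord = L := by
  rw [toWord_mk, h.reduce_eq]

lemma norm_mk_of_isReduced {L : List (α × Bool)} (h : IsReduced L) : (mk L).norm = L.length := by
  rw [norm, toWord_mk_of_isReduced h]

lemma exists_startsWith {v : FreeGroup α} (hv : v ≠ 1) : ∃ x, StartsWith x v := by
  rw [Ne, ← toWord_eq_nil_iff] at hv
  obtain ⟨x, l, h⟩ := List.exists_cons_of_ne_nil hv
  exact ⟨x, startsWith_iff.mpr ⟨l, h⟩⟩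

lemma toWord_letter_mul {x : α × Bool} {v : FreeGroup α} (h : ¬ StartsWith (invLetter x) v) :
    (letter x * v).toWord = x :: v.toWord := by
  have : letter x * v = mk (x :: v.toWord) := by
    conv_lhs => rw [← mk_toWord (x := v), letter, mul_mk]
    rfl
  rw [this]
  refine toWord_mk_of_isReduced (List.isChain_cons.mpr ⟨fun y hy hxy => ?_, isReduced_toWord⟩)
  by_contra hne
  refine h ?_
  rw [StartsWith, Option.mem_def.mp hy]
  congr 1
  ext
  · exact hxy.symm
  · simp only [invLetter]
    cases hb : x.2 <;> cases hc : y.2 <;> simp_all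

lemma StartsWith.toWord_inv_letter_mul {x : α × Bool} {v : FreeGroup α} (h : StartsWith x v) :
    x :: ((letter x)⁻¹ * v).toWord = v.toWord := by
  obtain ⟨l, hl⟩ := startsWith_iff.mp h
  have hr : IsReduced (x :: l) := hl ▸ isReduced_toWord
  have : (letter x)⁻¹ * v = mk l := by
    rw [inv_mul_eq_iff_eq_mul, letter, mul_mk, ← mk_toWord (x := v), hl]
    rfl
  rw [this, hl, toWord_mk_of_isReduced (L := l) (List.IsChain.tail hr)]

lemma startsWith_letter_mul_iff {x : α × Bool} {v : FreeGroup α} :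
    StartsWith x (letter x * v) ↔ ¬ StartsWith (invLetter x) v := by
  constructor
  · intro h h'
    have h1 := h.toWord_inv_letter_mul
    have h2 := h'.toWord_inv_letter_mul
    rw [inv_mul_cancel_left] at h1
    rw [letter_invLetter, inv_inv] at h2
    have h3 : IsReduced (letter x * v).toWord := isReduced_toWord
    rw [← h1, ← h2, isReduced_cons_cons] at h3
    have := h3.1 rfl
    simp [invLetter] at this
  · intro h
    exact startsWith_iff.mpr ⟨_, toWord_letter_mul h⟩

lemma norm_letter_mul {x : α × Bool} {v : FreeGroup α} (h : ¬ StartsWith (invLetter x) v) :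
    (letter x * v).norm = v.norm + 1 := by
  rw [norm, toWord_letter_mul h, List.length_cons, norm]

lemma StartsWith.norm_inv_letter_mul {x : α × Bool} {v : FreeGroup α} (h : StartsWith x v) :
    ((letter x)⁻¹ * v).norm + 1 = v.norm := by
  rw [norm, norm, ← h.toWord_inv_letter_mul, List.length_cons]

lemma norm_letter (x : α × Bool) : (letter x).norm = 1 := by
  rw [letter, norm_mk_of_isReduced IsReduced.singleton, List.length_singleton]

/-- A letter on the right either cancels the last letter or is appended; length at least two keeps
the first letter out of reach. -/
lemma StartsWith.mul_letter {x : α × Bool} {v : FreeGroup α} (h : StartsWith x v)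
    (hv : 2 ≤ v.norm) (z : α × Bool) : StartsWith x (v * letter z) := by
  obtain ⟨l, hl⟩ := startsWith_iff.mp h
  rcases List.eq_nil_or_concat' l with rfl | ⟨l', y, rfl⟩
  · simp [norm, hl] at hv
  have hr : IsReduced (x :: (l' ++ [y])) := hl ▸ isReduced_toWord
  have hv' : v = mk (x :: (l' ++ [y])) := by rw [← hl, mk_toWord]
  rw [startsWith_iff]
  by_cases hyz : y = invLetter z
  · refine ⟨l', ?_⟩
    have : v * letter z = mk (x :: l') := by
      have e : mk (x :: (l' ++ [y])) = mk (x :: l') * letter y := by rw [letter, mul_mk]; simp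
      rw [hv', e, hyz, letter_invLetter, inv_mul_cancel_right]
    rw [this]
    exact toWord_mk_of_isReduced (hr.infix (List.IsPrefix.isInfix ⟨[y], by simp⟩))
  · refine ⟨l' ++ [y] ++ [z], ?_⟩
    have : v * letter z = mk ((x :: l') ++ [y] ++ [z]) := by
      rw [hv', letter, mul_mk]; simp
    rw [this]
    refine (toWord_mk_of_isReduced (IsReduced.append_overlap (by simpa using hr) ?_ (by simp))).trans
      (by simp)
    rw [List.singleton_append, isReduced_cons_cons]
    refine ⟨fun h1 => ?_, .singleton⟩
    by_contra h2
    refine hyz (Prod.ext h1 ?_)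
    simp only [invLetter]
    cases hb : y.2 <;> cases hc : z.2 <;> simp_all

lemma StartsWith.mul_mk {x : α × Bool} (L : List (α × Bool)) :
    ∀ {v : FreeGroup α}, StartsWith x v → L.length < v.norm → StartsWith x (v * mk L) := by
  induction L with
  | nil => intro v h _; rwa [← one_eq_mk, mul_one]
  | cons z L ih =>
    intro v h hv
    rw [List.length_cons] at hv
    have e : v * mk (z :: L) = v * letter z * mk L := by
      rw [mul_assoc, letter, FreeGroup.mul_mk]; rfl
    have hn := norm_mul_le (v * letter z) (letter z)⁻¹
    rw [mul_inv_cancel_right, norm_inv_eq, norm_letter] at hn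
    rw [e]
    exact ih (h.mul_letter (by omega) z) (by omega)

/-- Right multiplication by a shorter element does not change the first letter. -/
lemma StartsWith.mul {x : α × Bool} {v h : FreeGroup α} (hv : StartsWith x v)
    (hn : h.norm < v.norm) : StartsWith x (v * h) := by
  rw [← mk_toWord (x := h)]
  exact hv.mul_mk _ hn

/-- The hypothesis `hg` says that `x` does not cancel against `g`. Two reduced words overlapping in
the letter `x` then concatenate to a reduced word. -/
lemma norm_mul_of_startsWith {x : α × Bool} {g w : FreeGroup α}
    (hg : (g * letter x).norm = g.norm + 1) (hw : StartsWith x w) :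
    (g * w).norm = g.norm + w.norm := by
  obtain ⟨l, hl⟩ := startsWith_iff.mp hw
  have e : g * letter x = mk (g.toWord ++ [x]) := by
    rw [← mul_mk, mk_toWord, letter]
  have h1 : IsReduced (g.toWord ++ [x]) := by
    rw [isReduced_iff_reduce_eq, ← toWord_mk, ← e]
    have hs := toWord_mul_sublist g (letter x)
    rw [letter, toWord_mk_of_isReduced .singleton] at hs
    exact hs.eq_of_length (by simpa [norm, letter] using hg)
  have h2 : IsReduced ([x] ++ l) := by
    rw [List.singleton_append, ← hl]; exact isReduced_toWord
  have h3 := h1.append_overlap h2 (by simp)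
  have e2 : g * w = mk (g.toWord ++ [x] ++ l) := by
    rw [List.append_assoc, List.singleton_append, ← hl, ← mul_mk, mk_toWord, mk_toWord]
  rw [e2, norm_mk_of_isReduced h3]
  simp [norm, hl]

lemma exists_eq_mul_letter {g : FreeGroup α} {a : ℕ} (hg : g.norm = a + 1) :
    ∃ g₁ x, g = g₁ * letter x ∧ g₁.norm = a := by
  rcases List.eq_nil_or_concat' g.toWord with h | ⟨l, x, h⟩
  · simp [norm, h] at hg
  · have hr : IsReduced (l ++ [x]) := h ▸ isReduced_toWord
    refine ⟨mk l, x, ?_, ?_⟩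
    · rw [letter, mul_mk, ← h, mk_toWord]
    · rw [norm_mk_of_isReduced (List.IsChain.left_of_append hr)]
      simpa [norm, h] using hg

variable [Fintype α]

lemma finite_norm_eq (n : ℕ) : {v : FreeGroup α | v.norm = n}.Finite :=
  Set.Finite.of_finite_image ((List.finite_length_eq (α × Bool) n).subset
    (by rintro _ ⟨v, hv, rfl⟩; exact hv)) toWord_injective.injOn

variable (α) in
/-- The sphere of radius `n` in the free group. -/
def sphere (n : ℕ) : Finset (FreeGroup α) := (finite_norm_eq n).toFinset

@[simp] lemma mem_sphere {n : ℕ} {v : FreeGroup α} : v ∈ sphere α n ↔ v.norm = n := by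
  simp [sphere]

lemma sum_sphere_letter_mul {M : Type*} [AddCommMonoid M] (x : α × Bool) (n : ℕ)
    (f : FreeGroup α → M) :
    ∑ v ∈ sphere α n with ¬ StartsWith (invLetter x) v, f (letter x * v) =
      ∑ w ∈ sphere α (n + 1) with StartsWith x w, f w := by
  refine Finset.sum_bij' (fun v _ => letter x * v) (fun w _ => (letter x)⁻¹ * w) ?_ ?_ ?_ ?_ ?_
  · intro v hv
    simp only [Finset.mem_filter, mem_sphere] at hv ⊢
    exact ⟨by rw [norm_letter_mul hv.2, hv.1], startsWith_letter_mul_iff.mpr hv.2⟩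
  · intro w hw
    simp only [Finset.mem_filter, mem_sphere] at hw ⊢
    refine ⟨by have := hw.2.norm_inv_letter_mul; omega, ?_⟩
    rw [← startsWith_letter_mul_iff, mul_inv_cancel_left]
    exact hw.2
  · intro v _; simp
  · intro w _; simp
  · intro v _; rfl

/-- Sum of `φ(|w h|)` over the words `w` of length `m` which begin with the letter `x`. -/
def cylinderSum (h : FreeGroup α) (x : α × Bool) (m : ℕ) (φ : ℕ → ℝ) : ℝ :=
  ∑ w ∈ sphere α m with StartsWith x w, φ (w * h).norm

/-- Sum of `φ(|g w h|)` over the words `w` of length `m`. -/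
def sphereSum (g h : FreeGroup α) (m : ℕ) (φ : ℕ → ℝ) : ℝ :=
  ∑ w ∈ sphere α m, φ (g * w * h).norm

/-- Deleting the first letter `x` leaves the words of length `m` not beginning with `x⁻¹`. As `h` is
too short to reach `x`, the deletion lowers `|w h|` by exactly one, whence the shift in `φ`. -/
lemma cylinderSum_succ {h : FreeGroup α} {m : ℕ} (hm : h.norm ≤ m) (x : α × Bool) (φ : ℕ → ℝ) :
    cylinderSum h x (m + 1) φ = sphereSum 1 h m (fun l => φ (l + 1)) -
      cylinderSum h (invLetter x) m fun l => φ (l + 1) := by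
  rw [cylinderSum, ← sum_sphere_letter_mul x m fun w => φ (w * h).norm, sphereSum, cylinderSum,
    eq_sub_iff_add_eq, ← Finset.sum_filter_add_sum_filter_not (sphere α m) (StartsWith (invLetter x)),
    add_comm]
  congr 1
  · simp
  · refine Finset.sum_congr rfl fun v hv => ?_
    simp only [Finset.mem_filter, mem_sphere] at hv
    have h1 := startsWith_letter_mul_iff.mpr hv.2
    have h2 := h1.mul (h := h) (by rw [norm_letter_mul hv.2]; omega)
    have h3 := h2.norm_inv_letter_mul
    rw [mul_assoc, inv_mul_cancel_left] at h3
    rw [one_mul, mul_assoc, h3]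

lemma abs_cylinderSum_le {φ : ℕ → ℝ} (hφ : ∀ l, |φ l| ≤ 1) (h : FreeGroup α) (x : α × Bool)
    (m : ℕ) : |cylinderSum h x m φ| ≤ (sphere α m).card := by
  refine (Finset.abs_sum_le_sum_abs _ _).trans ((Finset.sum_le_card_nsmul _ _ 1 fun _ _ => hφ _).trans ?_)
  rw [nsmul_one]
  exact_mod_cast Finset.card_filter_le _ _

lemma abs_sphereSum_le {φ : ℕ → ℝ} (hφ : ∀ l, |φ l| ≤ 1) (g h : FreeGroup α)
    (m : ℕ) : |sphereSum g h m φ| ≤ (sphere α m).card := by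
  refine (Finset.abs_sum_le_sum_abs _ _).trans ((Finset.sum_le_card_nsmul _ _ 1 fun _ _ => hφ _).trans ?_)
  rw [nsmul_one]

lemma exists_card_sphere_le (α : Type*) [DecidableEq α] [Fintype α] (b : ℕ) :
    ∃ C : ℝ, 0 ≤ C ∧ ∀ m ≤ b, ((sphere α m).card : ℝ) ≤ C := by
  refine ⟨∑ m ∈ Finset.range (b + 1), ((sphere α m).card : ℝ), by positivity, fun m hm => ?_⟩
  exact Finset.single_le_sum (f := fun m => ((sphere α m).card : ℝ)) (fun _ _ => by positivity)
    (Finset.mem_range.mpr (by omega))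

/-- The number of words with a given first letter and given behaviour at the end depends on the
first letter only up to a bounded error. -/
lemma exists_cylinderSum_sub_le (h : FreeGroup α) : ∃ C : ℝ, ∀ (m : ℕ) (x y : α × Bool)
    (φ : ℕ → ℝ), (∀ l, |φ l| ≤ 1) → |cylinderSum h x m φ - cylinderSum h y m φ| ≤ C := by
  obtain ⟨C, -, hC⟩ := exists_card_sphere_le α h.norm
  have small : ∀ m ≤ h.norm, ∀ (x y : α × Bool) (φ : ℕ → ℝ), (∀ l, |φ l| ≤ 1) →
      |cylinderSum h x m φ - cylinderSum h y m φ| ≤ 2 * C := fun m hm x y φ hφ =>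
    (abs_sub _ _).trans (by
      linarith [abs_cylinderSum_le hφ h x m, abs_cylinderSum_le hφ h y m, hC m hm])
  refine ⟨2 * C, fun m => ?_⟩
  induction m with
  | zero => exact small 0 (Nat.zero_le _)
  | succ m ih =>
    intro x y φ hφ
    rcases Nat.lt_or_ge m h.norm with hm | hm
    · exact small _ hm x y φ hφ
    -- The whole-sphere term does not depend on the letter and cancels, leaving a difference of
    -- cylinders of length `m`. The error therefore does not grow with `m`.
    · rw [cylinderSum_succ hm, cylinderSum_succ hm, sub_sub_sub_cancel_left]
      exact ih _ _ _ fun l => hφ _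

/-- Split the words `w` by whether they cancel `x`. If not, `x w` has length `m + 2` and begins with
`x`; if so, deleting `x⁻¹` leaves a word of length `m` not beginning with `x`. On the cylinder terms
`g` contributes exactly its length, since `w h` still begins with `x`. -/
lemma sphereSum_mul_letter {g h : FreeGroup α} {x : α × Bool}
    (hg : (g * letter x).norm = g.norm + 1) {m : ℕ} (hm : h.norm < m) (φ : ℕ → ℝ) :
    sphereSum (g * letter x) h (m + 1) φ = sphereSum g h m φ +
      (cylinderSum h x (m + 2) (fun l => φ (g.norm + l)) -
        cylinderSum h x m fun l => φ (g.norm + l)) := by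
  have key : ∀ n, h.norm < n → ∑ w ∈ sphere α n with StartsWith x w, φ (g * w * h).norm =
      cylinderSum h x n fun l => φ (g.norm + l) := fun n hn => by
    refine Finset.sum_congr rfl fun w hw => ?_
    simp only [Finset.mem_filter, mem_sphere] at hw
    rw [mul_assoc, norm_mul_of_startsWith hg (hw.2.mul (by omega))]
  have h1 := sum_sphere_letter_mul x (m + 1) fun w => φ (g * w * h).norm
  have h2 := sum_sphere_letter_mul (invLetter x) m fun w => φ (g * letter x * w * h).norm
  rw [key _ (by omega)] at h1
  simp only [invLetter_invLetter, letter_invLetter, mul_assoc, mul_inv_cancel_left] at h2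
  rw [sphereSum, ← Finset.sum_filter_add_sum_filter_not _ (StartsWith (invLetter x)), sphereSum,
    ← Finset.sum_filter_add_sum_filter_not (sphere α m) (StartsWith x), key m hm]
  simp only [mul_assoc] at h1 ⊢
  rw [h1, ← h2]
  ring

/-- The distribution of the length of `g w h` over words `w` of a given length depends on `g` only
through `|g|`, up to a bounded error. -/
lemma exists_sphereSum_sub_le (h : FreeGroup α) (a : ℕ) : ∃ C : ℝ, ∀ g g' : FreeGroup α,
    g.norm = a → g'.norm = a → ∀ (m : ℕ) (φ : ℕ → ℝ), (∀ l, |φ l| ≤ 1) →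
      |sphereSum g h m φ - sphereSum g' h m φ| ≤ C := by
  induction a with
  | zero =>
    refine ⟨0, fun g g' hg hg' m φ _ => ?_⟩
    rw [norm_eq_zero.mp hg, norm_eq_zero.mp hg', sub_self, abs_zero]
  | succ a ih =>
    obtain ⟨C₁, h₁⟩ := ih
    obtain ⟨C₂, h₂⟩ := exists_cylinderSum_sub_le h
    obtain ⟨C₃, h0, h₃⟩ := exists_card_sphere_le α (h.norm + 1)
    -- `C₁` is the error for `|g| - 1`, and each of the two cylinder terms costs `C₂`; words too
    -- short for the recursion are bounded by counting.
    refine ⟨max (C₁ + 2 * C₂) (2 * C₃), fun g g' hg hg' m φ hφ => ?_⟩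
    rcases Nat.lt_or_ge (h.norm + 1) m with hm | hm
    · obtain ⟨n, rfl⟩ : ∃ n, m = n + 1 := ⟨m - 1, by omega⟩
      obtain ⟨g₁, x, rfl, hg₁⟩ := exists_eq_mul_letter hg
      obtain ⟨g₂, y, rfl, hg₂⟩ := exists_eq_mul_letter hg'
      refine le_max_of_le_left ?_
      rw [sphereSum_mul_letter (by omega) (by omega), sphereSum_mul_letter (by omega) (by omega),
        hg₁, hg₂]
      have e1 := abs_le.mp (h₁ g₁ g₂ hg₁ hg₂ n φ hφ)
      have e2 := abs_le.mp (h₂ (n + 2) x y (fun l => φ (a + l)) fun l => hφ _)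
      have e3 := abs_le.mp (h₂ n x y (fun l => φ (a + l)) fun l => hφ _)
      rw [abs_le]
      constructor <;> linarith
    · refine le_max_of_le_right ((abs_sub _ _).trans ?_)
      linarith [abs_sphereSum_le hφ g h m, abs_sphereSum_le hφ g' h m, h₃ m hm]

end FreeGroup

/-! ### The sphere operators and the orthogonal basis of L²(B). -/

section Radial

open FreeGroup

variable {k : ℕ}

lemma sum_leftRegular_deltaOne_apply {G : Type*} [Group G] [DecidableEq G] (s : Finset G) (h : G) :
    (∑ v ∈ s, leftRegular v) (deltaOne G) h = if h ∈ s then 1 else 0 := by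
  rw [_root_.sum_apply, lp.coeFn_sum, Finset.sum_apply]
  simp [leftRegular_deltaOne_apply, -leftRegular_apply]

lemma freeLaplacian_eq : freeLaplacian k = ∑ x : Fin k × Bool, leftRegular (letter x) := by
  rw [freeLaplacian, Fintype.sum_prod_type]
  refine Finset.sum_congr rfl fun i _ => ?_
  rw [Fintype.sum_bool]
  simp only [letter, of]
  congr 2

lemma star_freeLaplacian : star (freeLaplacian k) = freeLaplacian k := by
  rw [freeLaplacian, star_sum]
  refine Finset.sum_congr rfl fun i _ => ?_
  rw [star_add, star_leftRegular, star_leftRegular, inv_inv, add_comm]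

variable (k) in
/-- The sum `wₙ` of the words of length `n`, as a convolution operator. -/
def sphereOp (n : ℕ) : EllTwo (FreeGroup (Fin k)) →L[ℂ] EllTwo (FreeGroup (Fin k)) :=
  ∑ v ∈ sphere (Fin k) n, leftRegular v

variable (k) in
/-- The indicator function of the sphere of radius `n`. -/
def sphereVec (n : ℕ) : EllTwo (FreeGroup (Fin k)) :=
  sphereOp k n (deltaOne _)

lemma sphereVec_apply (n : ℕ) (v : FreeGroup (Fin k)) :
    sphereVec k n v = if v.norm = n then 1 else 0 := by
  rw [sphereVec, sphereOp, sum_leftRegular_deltaOne_apply]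
  simp

lemma sphereOp_zero : sphereOp k 0 = 1 := by
  have : sphere (Fin k) 0 = {1} := by ext; simp
  rw [sphereOp, this, Finset.sum_singleton, leftRegular_one]

lemma sphereVec_zero : sphereVec k 0 = deltaOne _ := by
  rw [sphereVec, sphereOp_zero]; rfl

variable (k) in
/-- The number of neighbours at distance `n + 1` of a point at distance `n` from the identity. -/
def branching (n : ℕ) : ℝ := if n = 0 then 2 * (k : ℝ) else 2 * (k : ℝ) - 1

/-- In the Cayley tree, exactly one neighbour of `v ≠ 1` is closer to the identity: the one obtained
by deleting the first letter. -/
lemma sum_letters {v : FreeGroup (Fin k)} (hv : v ≠ 1) (f : ℕ → ℂ) :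
    ∑ x : Fin k × Bool, f ((letter x)⁻¹ * v).norm =
      f (v.norm - 1) + (2 * (k : ℂ) - 1) * f (v.norm + 1) := by
  obtain ⟨x, hx⟩ := exists_startsWith hv
  rw [← Finset.add_sum_erase _ _ (Finset.mem_univ x)]
  congr 1
  · rw [← hx.norm_inv_letter_mul, Nat.add_sub_cancel]
  · have : ∀ y ∈ Finset.univ.erase x, f ((letter y)⁻¹ * v).norm = f (v.norm + 1) := fun y hy => by
      rw [← letter_invLetter, norm_letter_mul]
      rw [invLetter_invLetter]
      intro h
      exact Finset.ne_of_mem_erase hy (h.eq hx)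
    rw [Finset.sum_congr rfl this, Finset.sum_const, Finset.card_erase_of_mem (Finset.mem_univ x),
      nsmul_eq_mul]
    congr 1
    have hpos : 1 ≤ (Finset.univ : Finset (Fin k × Bool)).card :=
      Finset.card_pos.mpr ⟨x, Finset.mem_univ x⟩
    rw [Nat.cast_sub hpos]
    simp [mul_comm]

lemma freeLaplacian_apply (f : EllTwo (FreeGroup (Fin k))) (v : FreeGroup (Fin k)) :
    freeLaplacian k f v = ∑ x : Fin k × Bool, f ((letter x)⁻¹ * v) := by
  rw [freeLaplacian_eq, _root_.sum_apply, lp.coeFn_sum, Finset.sum_apply]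
  rfl

lemma freeLaplacian_sphereVec_apply (n : ℕ) (v : FreeGroup (Fin k)) :
    freeLaplacian k (sphereVec k n) v = if v = 1 then (if n = 1 then 2 * (k : ℂ) else 0)
      else (if v.norm - 1 = n then 1 else 0) + (2 * (k : ℂ) - 1) * (if v.norm + 1 = n then 1 else 0) := by
  rw [freeLaplacian_apply]
  simp only [sphereVec_apply]
  split_ifs with hv hn hn hn
  all_goals first
    | (rw [sum_letters hv fun l => if l = n then (1 : ℂ) else 0]; simp_all)
    | (subst hv; simp [norm_letter, mul_comm, eq_comm, *])

lemma freeLaplacian_sphereVec_zero : freeLaplacian k (sphereVec k 0) = sphereVec k 1 := by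
  ext v
  rw [freeLaplacian_sphereVec_apply, sphereVec_apply]
  by_cases hv : v = 1
  · subst hv; simp
  · have : 0 < v.norm := Nat.pos_of_ne_zero fun h => hv (norm_eq_zero.mp h)
    have e : v.norm - 1 = 0 ↔ v.norm = 1 := by omega
    simp [hv, e]

lemma freeLaplacian_sphereVec_succ (n : ℕ) : freeLaplacian k (sphereVec k (n + 1)) =
    sphereVec k (n + 2) + (branching k n : ℂ) • sphereVec k n := by
  ext v
  rw [freeLaplacian_sphereVec_apply, lp.coeFn_add, lp.coeFn_smul, Pi.add_apply, Pi.smul_apply,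
    sphereVec_apply, sphereVec_apply, branching, smul_eq_mul]
  by_cases hv : v = 1
  · subst hv
    by_cases hn : n = 0
    · simp [hn]
    · simp [hn, Ne.symm hn]
  · have : 0 < v.norm := Nat.pos_of_ne_zero fun h => hv (norm_eq_zero.mp h)
    have e : v.norm - 1 = n + 1 ↔ v.norm = n + 2 := by omega
    rw [if_neg hv]
    simp only [e, Nat.add_right_cancel_iff]
    congr 1
    by_cases h : v.norm = n
    · have hn : n ≠ 0 := by omega
      simp [h, hn]
    · simp [h]

lemma mem_laplacianAlgebra_iff {x : EllTwo (FreeGroup (Fin k)) →L[ℂ] EllTwo (FreeGroup (Fin k))} :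
    x ∈ laplacianAlgebra k ↔ ∀ m : EllTwo (FreeGroup (Fin k)) →L[ℂ] EllTwo (FreeGroup (Fin k)),
      freeLaplacian k * m = m * freeLaplacian k → m * x = x * m := by
  have h := coe_vonNeumannGenerated {freeLaplacian k}
  have hs : star {freeLaplacian k} = ({freeLaplacian k} : Set _) := by
    rw [Set.star_singleton, star_freeLaplacian]
  rw [hs, Set.union_self] at h
  rw [← SetLike.mem_coe, laplacianAlgebra, h, Set.mem_centralizer_iff]
  simp [Set.mem_centralizer_iff]

lemma freeLaplacian_mem : freeLaplacian k ∈ laplacianAlgebra k :=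
  mem_laplacianAlgebra_iff.mpr fun _ hm => hm.symm

lemma laplacianAlgebra_comm : ∀ a ∈ laplacianAlgebra k, ∀ b ∈ laplacianAlgebra k,
    a * b = b * a := fun a ha _ hb =>
  mem_laplacianAlgebra_iff.mp hb a (mem_laplacianAlgebra_iff.mp ha _ rfl)

lemma laplacianAlgebra_le : laplacianAlgebra k ≤ groupVN (FreeGroup (Fin k)) := fun _ ha =>
  mem_groupVN_iff.mpr fun m hm => mem_laplacianAlgebra_iff.mp ha m (by
    simp only [freeLaplacian_eq, Finset.sum_mul, Finset.mul_sum, hm])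

lemma sphereOp_mem_groupVN (n : ℕ) : sphereOp k n ∈ groupVN (FreeGroup (Fin k)) :=
  sum_mem fun _ _ => leftRegular_mem_groupVN _

lemma smul_mem_groupVN {G : Type*} [Group G] (c : ℂ) {x : EllTwo G →L[ℂ] EllTwo G}
    (hx : x ∈ groupVN G) : c • x ∈ groupVN G :=
  (groupVN G).toStarSubalgebra.smul_mem hx c

lemma freeLaplacian_mul_sphereOp_zero : freeLaplacian k * sphereOp k 0 = sphereOp k 1 :=
  eq_of_apply_deltaOne (mul_mem (laplacianAlgebra_le freeLaplacian_mem) (sphereOp_mem_groupVN _))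
    (sphereOp_mem_groupVN _) freeLaplacian_sphereVec_zero

lemma freeLaplacian_mul_sphereOp_succ (n : ℕ) : freeLaplacian k * sphereOp k (n + 1) =
    sphereOp k (n + 2) + (branching k n : ℂ) • sphereOp k n :=
  eq_of_apply_deltaOne (mul_mem (laplacianAlgebra_le freeLaplacian_mem) (sphereOp_mem_groupVN _))
    (add_mem (sphereOp_mem_groupVN _) (smul_mem_groupVN _ (sphereOp_mem_groupVN _)))
    (freeLaplacian_sphereVec_succ n)

lemma sphereOp_mem (n : ℕ) : sphereOp k n ∈ laplacianAlgebra k := by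
  induction n using Nat.twoStepInduction with
  | zero => rw [sphereOp_zero]; exact one_mem _
  | one =>
    rw [← freeLaplacian_mul_sphereOp_zero, sphereOp_zero, mul_one]
    exact freeLaplacian_mem
  | more n h0 h1 =>
    rw [eq_sub_of_add_eq (freeLaplacian_mul_sphereOp_succ n).symm]
    exact sub_mem (mul_mem freeLaplacian_mem h1)
      ((laplacianAlgebra k).toStarSubalgebra.smul_mem h0 _)

lemma sphereVec_mem (n : ℕ) : sphereVec k n ∈ deltaSpace (laplacianAlgebra k) :=
  apply_deltaOne_mem (sphereOp_mem n)

lemma inner_sphereVec (n : ℕ) (f : EllTwo (FreeGroup (Fin k))) :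
    inner ℂ (sphereVec k n) f = ∑ v ∈ sphere (Fin k) n, f v := by
  rw [sphereVec, sphereOp, _root_.sum_apply, sum_inner]
  exact Finset.sum_congr rfl fun v _ => inner_leftRegular_deltaOne v f

lemma inner_sphereVec_sphereVec (m n : ℕ) :
    inner ℂ (sphereVec k m) (sphereVec k n) =
      if m = n then ((sphere (Fin k) n).card : ℂ) else 0 := by
  rw [inner_sphereVec]
  simp only [sphereVec_apply]
  split_ifs with h
  · subst h
    rw [Finset.sum_congr rfl fun v hv => if_pos (mem_sphere.mp hv)]
    simp
  · refine Finset.sum_eq_zero fun v hv => if_neg ?_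
    rw [mem_sphere.mp hv]
    exact h

lemma inner_freeLaplacian (f g : EllTwo (FreeGroup (Fin k))) :
    inner ℂ (freeLaplacian k f) g = inner ℂ f (freeLaplacian k g) := by
  rw [← ContinuousLinearMap.adjoint_inner_right, ← ContinuousLinearMap.star_eq_adjoint,
    star_freeLaplacian]

lemma card_sphere_zero : (sphere (Fin k) 0).card = 1 := by
  have : sphere (Fin k) 0 = {1} := by ext; simp
  rw [this, Finset.card_singleton]

/-- Evaluate `⟨χₙ₊₁, w₁ χₙ⟩` in two ways, using that `w₁` is self-adjoint. -/
lemma card_sphere_succ (n : ℕ) :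
    ((sphere (Fin k) (n + 1)).card : ℝ) = branching k n * (sphere (Fin k) n).card := by
  have h1 : inner ℂ (sphereVec k (n + 1)) (freeLaplacian k (sphereVec k n)) =
      ((sphere (Fin k) (n + 1)).card : ℂ) := by
    rcases n with _ | n
    · rw [freeLaplacian_sphereVec_zero, inner_sphereVec_sphereVec, if_pos rfl]
    · rw [freeLaplacian_sphereVec_succ, inner_add_right, inner_smul_right,
        inner_sphereVec_sphereVec, inner_sphereVec_sphereVec, if_pos rfl, if_neg (by omega)]
      simp
  have h2 : inner ℂ (sphereVec k (n + 1)) (freeLaplacian k (sphereVec k n)) =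
      (branching k n : ℂ) * ((sphere (Fin k) n).card : ℂ) := by
    rw [← inner_freeLaplacian, freeLaplacian_sphereVec_succ, inner_add_left, inner_smul_left,
        inner_sphereVec_sphereVec, inner_sphereVec_sphereVec, if_pos rfl, if_neg (by omega)]
    simp
  exact_mod_cast h1.symm.trans h2

lemma three_pow_le_card_sphere (hk : 2 ≤ k) (n : ℕ) : (3 : ℝ) ^ n ≤ (sphere (Fin k) n).card := by
  have hk' : (2 : ℝ) ≤ k := by exact_mod_cast hk
  induction n with
  | zero => simp [card_sphere_zero]
  | succ n ih =>
    have hb : 3 ≤ branching k n := by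
      rw [branching]; split_ifs <;> linarith
    rw [card_sphere_succ, pow_succ']
    exact mul_le_mul hb ih (by positivity) (by linarith)

lemma norm_sphereVec (n : ℕ) : ‖sphereVec k n‖ = √(sphere (Fin k) n).card := by
  have h := inner_self_eq_norm_sq_to_K (𝕜 := ℂ) (sphereVec k n)
  rw [inner_sphereVec_sphereVec, if_pos rfl] at h
  have h' : ‖sphereVec k n‖ ^ 2 = (sphere (Fin k) n).card :=
    Complex.ofReal_injective (by simpa using h.symm)
  rw [← h', Real.sqrt_sq (norm_nonneg _)]

/-- A radial vector orthogonal to all spheres vanishes. -/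
lemma eq_zero_of_inner_sphereVec {f : EllTwo (FreeGroup (Fin k))}
    (hf : f ∈ deltaSpace (laplacianAlgebra k)) (h : ∀ n, inner ℂ (sphereVec k n) f = 0) :
    f = 0 := by
  set K := (Submodule.span ℂ (Set.range (sphereVec k))).topologicalClosure with hK
  have hmem : ∀ n, sphereVec k n ∈ K := fun n =>
    Submodule.le_topologicalClosure _ (Submodule.subset_span ⟨n, rfl⟩)
  have hinv : ∀ g ∈ K, freeLaplacian k g ∈ K := fun g hg => by
    have hle : Submodule.span ℂ (Set.range (sphereVec k)) ≤
        K.comap (freeLaplacian k).toLinearMap := by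
      rw [Submodule.span_le]
      rintro _ ⟨n, rfl⟩
      change freeLaplacian k (sphereVec k n) ∈ K
      rcases n with _ | n
      · rw [freeLaplacian_sphereVec_zero]; exact hmem 1
      · rw [freeLaplacian_sphereVec_succ]
        exact add_mem (hmem _) (K.smul_mem _ (hmem _))
    exact Submodule.topologicalClosure_minimal _ hle
      ((Submodule.isClosed_topologicalClosure _).preimage (freeLaplacian k).continuous) hg
  -- The projection onto `K` commutes with `w₁`, hence with all of `B` by the double commutant.
  -- Since `δ_e ∈ K`, this gives L²(B) ⊆ `K`.
  have hcomm := starProjection_comm K hinv (by rwa [star_freeLaplacian])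
  have hfK : f ∈ K := by
    refine deltaSpace_induction (p := fun f => f ∈ K) (Submodule.isClosed_topologicalClosure _)
      (fun a ha => ?_) hf
    have h1 := mem_laplacianAlgebra_iff.mp ha _ hcomm.symm
    have h2 := congrArg (fun T => T (deltaOne _)) h1
    simp only [mul_apply_eq_comp] at h2
    have h3 : deltaOne _ ∈ K := by rw [← sphereVec_zero]; exact hmem 0
    rw [Submodule.starProjection_eq_self_iff.mpr h3] at h2
    rw [← h2]
    exact Submodule.starProjection_apply_mem _ _
  have hKf : K ≤ (ℂ ∙ f)ᗮ := by
    refine Submodule.topologicalClosure_minimal _ (Submodule.span_le.mpr ?_)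
      (Submodule.isClosed_orthogonal _)
    rintro _ ⟨n, rfl⟩
    rw [SetLike.mem_coe, Submodule.mem_orthogonal_singleton_iff_inner_left]
    exact h n
  exact inner_self_eq_zero.mp (Submodule.mem_orthogonal_singleton_iff_inner_left.mp (hKf hfK))

/-- Expansion of a radial vector in the orthogonal basis of spheres. -/
lemma hasSum_sphereVec (hk : 2 ≤ k) {f : EllTwo (FreeGroup (Fin k))}
    (hf : f ∈ deltaSpace (laplacianAlgebra k)) :
    HasSum (fun n => (inner ℂ (sphereVec k n) f / ((sphere (Fin k) n).card : ℂ)) • sphereVec k n)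
      f := by
  have hpos : ∀ n, (0 : ℝ) < (sphere (Fin k) n).card := fun n =>
    lt_of_lt_of_le (by positivity) (three_pow_le_card_sphere hk n)
  let e : ℕ → deltaSpace (laplacianAlgebra k) := fun n =>
    ⟨((√(sphere (Fin k) n).card)⁻¹ : ℂ) • sphereVec k n, Submodule.smul_mem _ _ (sphereVec_mem n)⟩
  have he : Orthonormal ℂ e := by
    rw [orthonormal_iff_ite]
    intro m n
    change inner ℂ (((√(sphere (Fin k) m).card)⁻¹ : ℂ) • sphereVec k m)
      (((√(sphere (Fin k) n).card)⁻¹ : ℂ) • sphereVec k n) = _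
    rw [inner_smul_left, inner_smul_right, inner_sphereVec_sphereVec]
    split_ifs with h
    · subst h
      have h1 : ((√(sphere (Fin k) m).card : ℝ) : ℂ) * (√(sphere (Fin k) m).card : ℝ) =
        ((sphere (Fin k) m).card : ℂ) := by
        rw [← Complex.ofReal_mul, Real.mul_self_sqrt (hpos m).le, Complex.ofReal_natCast]
      have h2 : ((√(sphere (Fin k) m).card : ℝ) : ℂ) ≠ 0 :=
        Complex.ofReal_ne_zero.mpr (Real.sqrt_pos.mpr (hpos m)).ne'
      rw [← h1, map_inv₀, Complex.conj_ofReal]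
      field_simp
    · simp
  have hs : ∀ n, ((√(sphere (Fin k) n).card : ℝ) : ℂ) ≠ 0 := fun n =>
    Complex.ofReal_ne_zero.mpr (Real.sqrt_pos.mpr (hpos n)).ne'
  have hbot : (Submodule.span ℂ (Set.range e))ᗮ = ⊥ := by
    rw [Submodule.eq_bot_iff]
    intro z hz
    refine Subtype.ext (eq_zero_of_inner_sphereVec z.2 fun n => ?_)
    have h1 : inner ℂ (e n) z = 0 :=
      (Submodule.mem_orthogonal _ _).mp hz _ (Submodule.subset_span ⟨n, rfl⟩)
    change inner ℂ (((√(sphere (Fin k) n).card)⁻¹ : ℂ) • sphereVec k n) (z : EllTwo _) = 0 at h1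
    rw [inner_smul_left, mul_eq_zero] at h1
    refine h1.resolve_left ?_
    rw [map_inv₀, Complex.conj_ofReal]
    exact inv_ne_zero (hs n)
  let b := HilbertBasis.mkOfOrthogonalEqBot he hbot
  have h := (b.hasSum_repr ⟨f, hf⟩).mapL (deltaSpace (laplacianAlgebra k)).subtypeL
  convert! h using 2 with n
  rw [map_smul, HilbertBasis.repr_apply_apply]
  simp only [b, HilbertBasis.coe_mkOfOrthogonalEqBot]
  change _ = inner ℂ (((√(sphere (Fin k) n).card)⁻¹ : ℂ) • sphereVec k n) f •
    (((√(sphere (Fin k) n).card)⁻¹ : ℂ) • sphereVec k n)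
  rw [inner_smul_left, smul_smul, map_inv₀, Complex.conj_ofReal]
  congr 1
  have h1 : ((√(sphere (Fin k) n).card : ℝ) : ℂ) * (√(sphere (Fin k) n).card : ℝ) =
      ((sphere (Fin k) n).card : ℂ) := by
    rw [← Complex.ofReal_mul, Real.mul_self_sqrt (hpos n).le, Complex.ofReal_natCast]
  have := hs n
  rw [← h1]
  field_simp

end Radial

/-! ### Boundedness on spheres and its consequences for radial vectors. -/

section RadialEstimates

open FreeGroup

variable {k : ℕ}

lemma summable_inv_sqrt_card_sphere (hk : 2 ≤ k) :
    Summable fun n => (√(sphere (Fin k) n).card)⁻¹ := by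
  have h3 : (1 : ℝ) < √3 := by
    rw [Real.lt_sqrt zero_le_one]; norm_num
  refine Summable.of_nonneg_of_le (fun n => by positivity) (fun n => ?_)
    (summable_geometric_of_lt_one (r := (√3)⁻¹) (by positivity) (inv_lt_one_of_one_lt₀ h3))
  rw [inv_pow]
  refine inv_anti₀ (by positivity) ?_
  refine Real.le_sqrt_of_sq_le ?_
  rw [← pow_mul, mul_comm, pow_mul, Real.sq_sqrt (by norm_num)]
  exact three_pow_le_card_sphere hk n

/-- Serves two cases: a bounded coefficient on a sphere vector, and a coefficient of size `√|Sₙ|` on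
a bounded vector. Either way one square root survives in the denominator. -/
lemma norm_coeff_smul_le (hk : 2 ≤ k) (n : ℕ) {c : ℂ} {A B : ℝ} {H : Type*}
    [NormedAddCommGroup H] [NormedSpace ℂ H] {v : H} (h : ‖c‖ * ‖v‖ ≤
      A * B * √(sphere (Fin k) n).card) :
    ‖(c / ((sphere (Fin k) n).card : ℂ)) • v‖ ≤ A * B * (√(sphere (Fin k) n).card)⁻¹ := by
  have hpos : (0 : ℝ) < (sphere (Fin k) n).card :=
    lt_of_lt_of_le (by positivity) (three_pow_le_card_sphere hk n)
  rw [norm_smul, norm_div, Complex.norm_natCast, div_mul_eq_mul_div, div_le_iff₀ hpos]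
  refine h.trans (le_of_eq ?_)
  have h1 := Real.mul_self_sqrt hpos.le
  have h2 := Real.sqrt_pos.mpr hpos
  rw [mul_assoc (A * B)]
  congr 1
  field_simp
  rw [sq, h1]

/-- A radial vector with bounded sphere coefficients is bounded. -/
lemma norm_le_of_inner_sphereVec_le (hk : 2 ≤ k) {f : EllTwo (FreeGroup (Fin k))}
    (hf : f ∈ deltaSpace (laplacianAlgebra k)) {C : ℝ}
    (h : ∀ n, ‖(inner ℂ (sphereVec k n) f : ℂ)‖ ≤ C) :
    ‖f‖ ≤ C * ∑' n, (√(sphere (Fin k) n).card)⁻¹ := by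
  have hC : 0 ≤ C := (norm_nonneg _).trans (h 0)
  rw [← (hasSum_sphereVec hk hf).tsum_eq]
  refine tsum_of_norm_bounded ((summable_inv_sqrt_card_sphere hk).hasSum.mul_left C) fun n => ?_
  have := norm_coeff_smul_le hk n (c := inner ℂ (sphereVec k n) f) (v := sphereVec k n) (A := C)
    (B := 1) (by rw [norm_sphereVec, mul_one]; gcongr; exact h n)
  rwa [mul_one] at this

/-- An operator that is bounded on the (unnormalized) spheres maps bounded, weakly null families of
radial vectors to norm null families. -/
lemma tendsto_apply_of_radial (hk : 2 ≤ k) {ι : Type*} {l : Filter ι}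
    {ξ : ι → EllTwo (FreeGroup (Fin k))} (hξ : ∀ i, ξ i ∈ deltaSpace (laplacianAlgebra k))
    (hb : ∀ i, ‖ξ i‖ ≤ 1) (hw : ∀ n, Tendsto (fun i => inner ℂ (sphereVec k n) (ξ i)) l (𝓝 (0 : ℂ)))
    (T : EllTwo (FreeGroup (Fin k)) →L[ℂ] EllTwo (FreeGroup (Fin k))) {C : ℝ}
    (hT : ∀ n, ‖T (sphereVec k n)‖ ≤ C) : Tendsto (fun i => T (ξ i)) l (𝓝 0) := by
  have hC : 0 ≤ C := (norm_nonneg _).trans (hT 0)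
  have e : ∀ i, T (ξ i) = ∑' n, (inner ℂ (sphereVec k n) (ξ i) / ((sphere (Fin k) n).card : ℂ)) •
      T (sphereVec k n) := fun i => by
    have := (hasSum_sphereVec hk (hξ i)).mapL T
    simp only [map_smul] at this
    exact this.tsum_eq.symm
  have h0 : (0 : EllTwo (FreeGroup (Fin k))) = ∑' _ : ℕ, 0 := by simp
  simp only [e]
  rw [h0]
  -- Each term tends to zero by weak convergence; the majorant `C/√|Sₙ|` is independent of `i`.
  refine tendsto_tsum_of_dominated_convergence
    ((summable_inv_sqrt_card_sphere hk).mul_left (1 * C)) (fun n => ?_)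
    (Eventually.of_forall fun i n => norm_coeff_smul_le hk n ?_)
  · have := ((hw n).div_const ((sphere (Fin k) n).card : ℂ)).smul_const (T (sphereVec k n))
    simpa using this
  · have h1 : ‖(inner ℂ (sphereVec k n) (ξ i) : ℂ)‖ ≤ √(sphere (Fin k) n).card :=
      (norm_inner_le_norm _ _).trans (by
        rw [norm_sphereVec]; exact mul_le_of_le_one_right (by positivity) (hb i))
    rw [one_mul, mul_comm]
    exact mul_le_mul (hT n) h1 (norm_nonneg _) hC

lemma inner_deltaProj {G : Type*} [Group G] {N : VonNeumannAlgebra (EllTwo G)} {f g : EllTwo G}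
    (hf : f ∈ deltaSpace N) : inner ℂ f (deltaProj N g) = inner ℂ f g := by
  have h := Submodule.inner_starProjection_left_eq_right (deltaSpace N) f g
  rw [Submodule.starProjection_eq_self_iff.mpr hf] at h
  exact h.symm

lemma inner_sphereVec_translate (g h : FreeGroup (Fin k)) (l n : ℕ) :
    inner ℂ (sphereVec k l) (leftRegular g (rightRegular h⁻¹ (sphereVec k n))) =
      ((sphereSum g h n fun m => if m = l then 1 else 0 : ℝ) : ℂ) := by
  have e : leftRegular g (rightRegular h⁻¹ (sphereVec k n)) =
      ∑ w ∈ sphere (Fin k) n, leftRegular (g * w * h) (deltaOne _) := by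
    rw [sphereVec, rightRegular_apply_comm (sphereOp_mem_groupVN n), rightRegular_deltaOne, inv_inv,
      sphereOp, _root_.sum_apply, map_sum]
    refine Finset.sum_congr rfl fun w _ => ?_
    rw [leftRegular_mul, leftRegular_mul]
    rfl
  rw [e, inner_sum, sphereSum, Complex.ofReal_sum]
  refine Finset.sum_congr rfl fun w _ => ?_
  rw [← inner_conj_symm, inner_leftRegular_deltaOne, sphereVec_apply]
  split_ifs <;> simp

/-- Sandwiching spheres between `g` and `h` and projecting to the radial functions depends on `g`
only through `|g|`, up to a bounded error. -/
lemma exists_norm_deltaProj_translate_sub_le (hk : 2 ≤ k) (h : FreeGroup (Fin k)) (a : ℕ) :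
    ∃ C : ℝ, ∀ g g' : FreeGroup (Fin k), g.norm = a → g'.norm = a → ∀ n,
      ‖deltaProj (laplacianAlgebra k) ((leftRegular g - leftRegular g')
        (rightRegular h⁻¹ (sphereVec k n)))‖ ≤ C := by
  obtain ⟨C, hC⟩ := exists_sphereSum_sub_le h a
  refine ⟨_, fun g g' hg hg' n => norm_le_of_inner_sphereVec_le hk (deltaProj_mem _)
    (C := C) fun l => ?_⟩
  rw [inner_deltaProj (sphereVec_mem l), sub_apply, inner_sub_right, inner_sphereVec_translate,
    inner_sphereVec_translate, ← Complex.ofReal_sub, Complex.norm_real]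
  refine hC g g' hg hg' n _ fun m => ?_
  split_ifs <;> simp

/-- Both sides are radial and have the same inner product with every sphere. -/
lemma deltaProj_leftRegular (hk : 2 ≤ k) (g : FreeGroup (Fin k)) :
    deltaProj (laplacianAlgebra k) (leftRegular g (deltaOne _)) =
      ((sphere (Fin k) g.norm).card : ℂ)⁻¹ • sphereVec k g.norm := by
  have hpos : ((sphere (Fin k) g.norm).card : ℂ) ≠ 0 := by
    have : (0 : ℝ) < (sphere (Fin k) g.norm).card :=
      lt_of_lt_of_le (by positivity) (three_pow_le_card_sphere hk _)
    exact_mod_cast this.ne'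
  rw [← sub_eq_zero]
  refine eq_zero_of_inner_sphereVec (sub_mem (deltaProj_mem _)
    (Submodule.smul_mem _ _ (sphereVec_mem _))) fun n => ?_
  rw [inner_sub_right, inner_deltaProj (sphereVec_mem n), inner_smul_right,
    inner_sphereVec_sphereVec, ← inner_conj_symm, inner_leftRegular_deltaOne, sphereVec_apply]
  by_cases h : g.norm = n
  · subst h; simp [hpos]
  · simp [h, Ne.symm h]

/-- The difference of `λ(g)` and its conditional expectation, applied to spheres. -/
lemma exists_norm_deltaProj_sub_average_le (hk : 2 ≤ k) (g h : FreeGroup (Fin k)) :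
    ∃ C : ℝ, ∀ n, ‖deltaProj (laplacianAlgebra k)
      ((leftRegular g - ((sphere (Fin k) g.norm).card : ℂ)⁻¹ • sphereOp k g.norm)
        (rightRegular h⁻¹ (sphereVec k n)))‖ ≤ C := by
  obtain ⟨C, hC⟩ := exists_norm_deltaProj_translate_sub_le hk h g.norm
  have hpos : (0 : ℝ) < (sphere (Fin k) g.norm).card :=
    lt_of_lt_of_le (by positivity) (three_pow_le_card_sphere hk _)
  have hne : ((sphere (Fin k) g.norm).card : ℂ) ≠ 0 := by exact_mod_cast hpos.ne'
  refine ⟨C, fun n => ?_⟩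
  -- An average of differences between elements of equal length, so the bound for one difference
  -- passes to it.
  have e : leftRegular g - ((sphere (Fin k) g.norm).card : ℂ)⁻¹ • sphereOp k g.norm =
      ((sphere (Fin k) g.norm).card : ℂ)⁻¹ •
        ∑ g' ∈ sphere (Fin k) g.norm, (leftRegular g - leftRegular g') := by
    rw [Finset.sum_sub_distrib, smul_sub, Finset.sum_const, ← Nat.cast_smul_eq_nsmul ℂ,
      inv_smul_smul₀ hne, sphereOp]
  rw [e, _root_.smul_apply, _root_.sum_apply, map_smul, map_sum, norm_smul, norm_inv,
    Complex.norm_natCast, inv_mul_le_iff₀ hpos]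
  refine (norm_sum_le _ _).trans ((Finset.sum_le_card_nsmul _ _ C fun g' hg' => ?_).trans
    (le_of_eq (nsmul_eq_mul _ _)))
  exact hC g g' rfl (mem_sphere.mp hg') n

end RadialEstimates

/-! ### The spectral distribution of the Laplacian. -/

section KestenMeasure

open MeasureTheory intervalIntegral

lemma hasSum_intervalIntegral_of_bounded {E : Type*} [NormedAddCommGroup E] [NormedSpace ℝ E]
    {a b : ℝ} {f : ℕ → ℝ → E} {F : ℝ → E} {M : ℕ → ℝ} (hf : ∀ j, Continuous (f j))
    (hM : Summable M) (hb : ∀ j, ∀ t ∈ Set.uIcc a b, ‖f j t‖ ≤ M j)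
    (hF : ∀ t ∈ Set.uIcc a b, HasSum (fun j => f j t) (F t)) :
    HasSum (fun j => ∫ t in a..b, f j t) (∫ t in a..b, F t) :=
  hasSum_integral_of_dominated_convergence (fun j _ => M j)
    (fun j => (hf j).aestronglyMeasurable)
    (fun j => ae_of_all _ fun t ht => hb j t (Set.uIoc_subset_uIcc ht))
    (ae_of_all _ fun _ _ => hM) intervalIntegrable_const
    (ae_of_all _ fun t ht => hF t (Set.uIoc_subset_uIcc ht))

lemma integral_cos_int_mul {m : ℤ} (hm : m ≠ 0) :
    ∫ θ in (0 : ℝ)..Real.pi, Real.cos (m * θ) = 0 := by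
  rw [integral_comp_mul_left (fun x => Real.cos x) (Int.cast_ne_zero.mpr hm), integral_cos,
    Real.sin_int_mul_pi]
  simp

lemma integral_sin_nat_mul_sin (a b : ℕ) :
    ∫ θ in (0 : ℝ)..Real.pi, Real.sin (a * θ) * Real.sin ((b + 1 : ℕ) * θ) =
      if a = b + 1 then Real.pi / 2 else 0 := by
  have e : ∀ θ : ℝ, Real.sin (a * θ) * Real.sin ((b + 1 : ℕ) * θ) =
      (Real.cos (((a - (b + 1 : ℕ) : ℤ) : ℝ) * θ) - Real.cos (((a + (b + 1 : ℕ) : ℤ) : ℝ) * θ)) / 2 := by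
    intro θ
    push_cast
    rw [sub_mul, add_mul (a : ℝ), Real.cos_sub, Real.cos_add]
    ring
  simp only [e]
  rw [intervalIntegral.integral_div, intervalIntegral.integral_sub
    (Continuous.intervalIntegrable (by fun_prop) _ _)
    (Continuous.intervalIntegrable (by fun_prop) _ _), integral_cos_int_mul (m := a + (b + 1 : ℕ)) (by omega)]
  split_ifs with h
  · subst h; simp
  · rw [integral_cos_int_mul (by omega)]; simp

/-- The density, up to the factor `sin`, of the spectral distribution of the Laplacian in the
angular variable. -/
def angularDensity (q θ : ℝ) : ℝ := ∑' j : ℕ, q⁻¹ ^ j * Real.sin ((2 * j + 1 : ℕ) * θ)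

variable {q : ℝ}

lemma norm_angular_term_le (hq : 1 < q) (j : ℕ) (θ : ℝ) :
    ‖q⁻¹ ^ j * Real.sin ((2 * j + 1 : ℕ) * θ)‖ ≤ q⁻¹ ^ j := by
  have : 0 ≤ q⁻¹ ^ j := by positivity
  rw [norm_mul, Real.norm_of_nonneg this]
  exact mul_le_of_le_one_right this (Real.abs_sin_le_one _)

lemma summable_inv_pow (hq : 1 < q) : Summable fun j : ℕ => q⁻¹ ^ j :=
  summable_geometric_of_lt_one (by positivity) (inv_lt_one_of_one_lt₀ hq)

lemma continuous_angularDensity (hq : 1 < q) : Continuous (angularDensity q) :=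
  continuous_tsum (fun j => by fun_prop) (summable_inv_pow hq) (norm_angular_term_le hq)

lemma hasSum_integral_sin_mul_angularDensity (hq : 1 < q) (a : ℕ) :
    HasSum (fun j : ℕ => q⁻¹ ^ j * if a = 2 * j + 1 then Real.pi / 2 else 0)
      (∫ θ in (0 : ℝ)..Real.pi, Real.sin (a * θ) * angularDensity q θ) := by
  have h := hasSum_intervalIntegral_of_bounded (a := 0) (b := Real.pi)
    (f := fun (j : ℕ) θ => Real.sin (a * θ) * (q⁻¹ ^ j * Real.sin ((2 * j + 1 : ℕ) * θ)))
    (F := fun θ => Real.sin (a * θ) * angularDensity q θ)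
    (fun j => by fun_prop) (summable_inv_pow hq) (fun j θ _ => by
      rw [norm_mul]
      exact (mul_le_of_le_one_left (norm_nonneg _) (Real.abs_sin_le_one _)).trans
        (norm_angular_term_le hq j θ)) (fun θ _ => by
      exact (Summable.of_norm_bounded (summable_inv_pow hq)
        fun j => norm_angular_term_le hq j θ).hasSum.mul_left _)
  convert! h using 2 with j
  rw [← integral_sin_nat_mul_sin a (2 * j), ← intervalIntegral.integral_const_mul]
  congr 1
  ext θ
  ring

lemma integral_sin_even_mul_angularDensity (hq : 1 < q) (i : ℕ) :
    ∫ θ in (0 : ℝ)..Real.pi, Real.sin ((2 * i : ℕ) * θ) * angularDensity q θ = 0 := by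
  refine (hasSum_integral_sin_mul_angularDensity hq (2 * i)).unique ?_
  convert! hasSum_zero using 2 with j
  rw [if_neg (by omega), mul_zero]

lemma integral_sin_odd_mul_angularDensity (hq : 1 < q) (i : ℕ) :
    ∫ θ in (0 : ℝ)..Real.pi, Real.sin ((2 * i + 1 : ℕ) * θ) * angularDensity q θ =
      q⁻¹ ^ i * (Real.pi / 2) := by
  refine (hasSum_integral_sin_mul_angularDensity hq (2 * i + 1)).unique ?_
  convert! hasSum_single (f := fun j : ℕ =>
    q⁻¹ ^ j * if 2 * i + 1 = 2 * j + 1 then Real.pi / 2 else 0) i (fun j hj => ?_) using 1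
  · simp
  · rw [if_neg (by omega), mul_zero]

variable (k : ℕ)

/-- The polynomials `pₙ` with `pₙ(w₁) = wₙ`. -/
def spherePoly : ℕ → ℝ → ℝ
  | 0, _ => 1
  | 1, t => t
  | n + 2, t => t * spherePoly (n + 1) t - branching k n * spherePoly n t

lemma continuous_spherePoly (n : ℕ) : Continuous (spherePoly k n) := by
  induction n using Nat.twoStepInduction with
  | zero => exact continuous_const
  | one => exact continuous_id
  | more n h0 h1 =>
    change Continuous fun t => t * spherePoly k (n + 1) t - branching k n * spherePoly k n t
    fun_prop

variable {k}

/-- In `t = 2 r cos θ` the recursion becomes that of sines of multiples of `θ`. It has constant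
coefficient `r²` except for `branching k 0 = r² + 1`, so the formula begins at index one and `m = 1`
is checked by hand. -/
lemma spherePoly_mul_sin {r : ℝ} (hr : r ^ 2 = 2 * k - 1) (m : ℕ) (θ : ℝ) :
    r * spherePoly k (m + 1) (2 * r * Real.cos θ) * Real.sin θ =
      r ^ (m + 2) * Real.sin ((m + 2 : ℕ) * θ) - r ^ m * Real.sin (m * θ) := by
  have trig : ∀ x : ℝ, 2 * Real.cos θ * Real.sin x = Real.sin (x + θ) + Real.sin (x - θ) :=
    fun x => by rw [Real.sin_add, Real.sin_sub]; ring
  induction m using Nat.twoStepInduction with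
  | zero =>
    simp only [spherePoly]
    push_cast
    rw [Real.sin_two_mul, zero_mul, Real.sin_zero]; ring
  | one =>
    simp only [spherePoly, branching, if_pos]
    have h2 := trig (2 * θ)
    rw [show 2 * θ + θ = 3 * θ by ring, show 2 * θ - θ = θ by ring, Real.sin_two_mul] at h2
    push_cast
    rw [one_mul]
    linear_combination (r * Real.sin θ) * hr + r ^ 3 * h2
  | more m h0 h1 =>
    have e : spherePoly k (m + 2 + 1) (2 * r * Real.cos θ) = (2 * r * Real.cos θ) *
      spherePoly k (m + 1 + 1) (2 * r * Real.cos θ) - r ^ 2 *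
      spherePoly k (m + 1) (2 * r * Real.cos θ) := by
      rw [hr]
      conv_lhs => rw [spherePoly]
      simp [branching]
    have t1 := trig ((m + 3 : ℕ) * θ)
    have t2 := trig ((m + 1 : ℕ) * θ)
    rw [show ((m + 3 : ℕ) : ℝ) * θ + θ = (m + 4 : ℕ) * θ by push_cast; ring,
      show ((m + 3 : ℕ) : ℝ) * θ - θ = (m + 2 : ℕ) * θ by push_cast; ring] at t1
    rw [show ((m + 1 : ℕ) : ℝ) * θ + θ = (m + 2 : ℕ) * θ by push_cast; ring,
      show ((m + 1 : ℕ) : ℝ) * θ - θ = m * θ by push_cast; ring] at t2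
    rw [e]
    change _ = r ^ (m + 4) * Real.sin ((m + 4 : ℕ) * θ) - r ^ (m + 2) * Real.sin ((m + 2 : ℕ) * θ)
    change r * spherePoly k (m + 1 + 1) _ * _ = r ^ (m + 3) * Real.sin ((m + 3 : ℕ) * θ) -
      r ^ (m + 1) * Real.sin ((m + 1 : ℕ) * θ) at h1
    linear_combination (2 * r * Real.cos θ) * h1 - r ^ 2 * h0 + r ^ (m + 4) * t1 - r ^ (m + 2) * t2

/-- Up to the factor `2/π`, this is `⟨χₙ, δ_e⟩`; with the recursion it determines all the moments.
-/
lemma integral_spherePoly {r : ℝ} (hr : r ^ 2 = 2 * k - 1) (hr0 : 1 < r) (n : ℕ) :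
    ∫ θ in (0 : ℝ)..Real.pi, spherePoly k n (2 * r * Real.cos θ) *
      (Real.sin θ * angularDensity (r ^ 2) θ) = if n = 0 then Real.pi / 2 else 0 := by
  have hq : 1 < r ^ 2 := one_lt_pow₀ hr0 two_ne_zero
  have hc := continuous_angularDensity hq
  rcases n with _ | m
  · simpa [spherePoly] using integral_sin_odd_mul_angularDensity hq 0
  · have h : r * ∫ θ in (0 : ℝ)..Real.pi, spherePoly k (m + 1) (2 * r * Real.cos θ) *
        (Real.sin θ * angularDensity (r ^ 2) θ) =
        r ^ (m + 2) * (∫ θ in (0 : ℝ)..Real.pi, Real.sin ((m + 2 : ℕ) * θ) * angularDensity (r ^ 2) θ) -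
        r ^ m * ∫ θ in (0 : ℝ)..Real.pi, Real.sin (m * θ) * angularDensity (r ^ 2) θ := by
      rw [← intervalIntegral.integral_const_mul, ← intervalIntegral.integral_const_mul,
        ← intervalIntegral.integral_const_mul, ← intervalIntegral.integral_sub
        (Continuous.intervalIntegrable (by fun_prop) _ _)
        (Continuous.intervalIntegrable (by fun_prop) _ _)]
      congr 1
      ext θ
      linear_combination angularDensity (r ^ 2) θ * spherePoly_mul_sin hr m θ
    rw [if_neg (Nat.succ_ne_zero m)]
    refine (mul_eq_zero.mp (h.trans ?_)).resolve_left (by positivity)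
    rcases Nat.even_or_odd' m with ⟨i, rfl | rfl⟩
    · rw [integral_sin_even_mul_angularDensity hq,
        show 2 * i + 2 = 2 * (i + 1) by ring, integral_sin_even_mul_angularDensity hq]
      ring
    -- The two sine terms cancel because `r² q⁻¹ = 1`, which is what dictates the coefficients `q⁻ʲ`
    -- of the density.
    · rw [integral_sin_odd_mul_angularDensity hq,
        show 2 * i + 1 + 2 = 2 * (i + 1) + 1 by ring, integral_sin_odd_mul_angularDensity hq]
      have : r ≠ 0 := by positivity
      rw [pow_succ (r ^ 2)⁻¹, pow_add r _ 2]
      generalize ((r ^ 2)⁻¹) ^ i = x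
      field_simp
      ring

/-- The mixed moments of the Laplacian are those of its spectral distribution. -/
lemma inner_sphereVec_pow {r : ℝ} (hr : r ^ 2 = 2 * k - 1) (hr0 : 1 < r) (j : ℕ) : ∀ n,
    (inner ℂ (sphereVec k n) ((freeLaplacian k ^ j) (deltaOne _)) : ℂ) =
      ((2 / Real.pi * ∫ θ in (0 : ℝ)..Real.pi, (2 * r * Real.cos θ) ^ j *
        (spherePoly k n (2 * r * Real.cos θ) * (Real.sin θ * angularDensity (r ^ 2) θ)) : ℝ) : ℂ) := by
  have hq : 1 < r ^ 2 := one_lt_pow₀ hr0 two_ne_zero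
  have hc := continuous_angularDensity hq
  have hp := continuous_spherePoly k
  induction j with
  | zero =>
    intro n
    simp only [pow_zero, one_mul]
    rw [integral_spherePoly hr hr0, one_apply_eq_self, ← sphereVec_zero,
      inner_sphereVec_sphereVec, card_sphere_zero]
    split_ifs
    · have := Real.pi_ne_zero
      rw [show 2 / Real.pi * (Real.pi / 2) = 1 by field_simp]
      simp
    · simp
  | succ j ih =>
    intro n
    -- One factor `w₁` moves onto `χₙ`, where it acts as multiplication by `t` does on `pₙ`.
    rw [pow_succ', mul_apply_eq_comp, ← inner_freeLaplacian]
    rcases n with _ | n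
    · rw [freeLaplacian_sphereVec_zero, ih]
      congr 3
      ext θ
      simp only [spherePoly]
      ring
    · rw [freeLaplacian_sphereVec_succ, inner_add_left, inner_smul_left, ih, ih, Complex.conj_ofReal,
        ← Complex.ofReal_mul, ← Complex.ofReal_add]
      congr 1
      rw [mul_left_comm, ← mul_add, ← intervalIntegral.integral_const_mul,
        ← intervalIntegral.integral_add
        (Continuous.intervalIntegrable (by fun_prop) _ _)
        (Continuous.intervalIntegrable (by fun_prop) _ _)]
      congr 2
      ext θ
      simp only [spherePoly]
      ring

end KestenMeasure

/-! ### Riemann–Lebesgue decay of the unitary group of the Laplacian. -/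

section OscillatoryDecay

open MeasureTheory intervalIntegral

variable {k : ℕ}

lemma inner_sphereVec_exp {r : ℝ} (hr : r ^ 2 = 2 * k - 1) (hr0 : 1 < r) (n : ℕ) (s : ℝ) :
    (inner ℂ (sphereVec k n)
      (NormedSpace.exp ((s * Complex.I : ℂ) • freeLaplacian k) (deltaOne _)) : ℂ) =
      2 / Real.pi * ∫ θ in (0 : ℝ)..Real.pi, Complex.exp (s * Complex.I * (2 * r * Real.cos θ : ℝ)) *
        ((spherePoly k n (2 * r * Real.cos θ) *
          (Real.sin θ * angularDensity (r ^ 2) θ) : ℝ) : ℂ) := by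
  have hq : 1 < r ^ 2 := one_lt_pow₀ hr0 two_ne_zero
  have hc := continuous_angularDensity hq
  have hp := continuous_spherePoly k n
  let φ : (EllTwo (FreeGroup (Fin k)) →L[ℂ] EllTwo (FreeGroup (Fin k))) →L[ℂ] ℂ :=
    (innerSL ℂ (sphereVec k n)).comp (ContinuousLinearMap.apply ℂ _ (deltaOne _))
  have h1 := (NormedSpace.exp_series_hasSum_exp' (𝕂 := ℂ)
    ((s * Complex.I : ℂ) • freeLaplacian k)).mapL φ
  set F : ℝ → ℝ := fun θ => spherePoly k n (2 * r * Real.cos θ) *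
    (Real.sin θ * angularDensity (r ^ 2) θ) with hF
  have hFc : Continuous F := by fun_prop
  obtain ⟨B, hB⟩ := (isCompact_uIcc (a := (0 : ℝ)) (b := Real.pi)).exists_bound_of_continuousOn
    hFc.continuousOn
  have h2 := hasSum_intervalIntegral_of_bounded (a := 0) (b := Real.pi)
    (f := fun (j : ℕ) θ => (j.factorial⁻¹ : ℂ) * (s * Complex.I * (2 * r * Real.cos θ : ℝ)) ^ j *
      ((F θ : ℝ) : ℂ))
    (F := fun θ => Complex.exp (s * Complex.I * (2 * r * Real.cos θ : ℝ)) * ((F θ : ℝ) : ℂ))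
    (M := fun j => (j.factorial : ℝ)⁻¹ * (|s| * (2 * r)) ^ j * B)
    (fun j => by fun_prop)
    (((Real.summable_pow_div_factorial _).congr fun j => by
      rw [div_eq_mul_inv, mul_comm]).mul_right B)
    (fun j θ hθ => by
      rw [norm_mul, norm_mul, norm_pow, norm_mul, norm_mul, Complex.norm_I, mul_one, norm_inv,
        Complex.norm_natCast, Complex.norm_real, Complex.norm_real, Complex.norm_real]
      gcongr
      · exact le_rfl
      · rw [Real.norm_eq_abs, abs_mul, abs_of_pos (by positivity : 0 < 2 * r)]
        exact mul_le_of_le_one_right (by positivity) (Real.abs_cos_le_one θ)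
      · exact hB θ hθ)
    (fun θ _ => by
      have := NormedSpace.exp_series_hasSum_exp' (𝕂 := ℂ)
        (s * Complex.I * (2 * r * Real.cos θ : ℝ) : ℂ)
      rw [← Complex.exp_eq_exp_ℂ] at this
      simpa only [smul_eq_mul] using this.mul_right ((F θ : ℝ) : ℂ))
  have h3 := h2.mul_left (2 / Real.pi : ℂ)
  refine h1.unique ?_
  convert! h3 using 2 with j
  rw [map_smul, smul_pow, map_smul]
  change _ • (_ • (inner ℂ (sphereVec k n) ((freeLaplacian k ^ j) (deltaOne _)) : ℂ)) = _
  rw [inner_sphereVec_pow hr hr0, Complex.ofReal_mul, ← intervalIntegral.integral_ofReal,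
    smul_eq_mul, smul_eq_mul, ← intervalIntegral.integral_const_mul,
    ← intervalIntegral.integral_const_mul, ← intervalIntegral.integral_const_mul,
    ← intervalIntegral.integral_const_mul]
  congr 1
  ext θ
  simp only [hF]
  push_cast
  ring

/-- Riemann–Lebesgue in the angular variable. -/
lemma tendsto_integral_exp_cos {r : ℝ} (hr : 0 < r) {f g : ℝ → ℝ} (hf : Continuous f)
    (hg : Continuous g) :
    Tendsto (fun s : ℝ => ∫ θ in (0 : ℝ)..Real.pi,
      Complex.exp (s * Complex.I * (r * Real.cos θ : ℝ)) *
        ((f (r * Real.cos θ) * (Real.sin θ * g θ) : ℝ) : ℂ)) (cocompact ℝ) (𝓝 0) := by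
  -- The substitution `t = r cos θ` absorbs the factor `sin θ` as its Jacobian, leaving a continuous
  -- density on `[-r, r]`.
  set h : ℝ → ℂ := fun t => ((r⁻¹ * (f t * g (Real.arccos (t / r))) : ℝ) : ℂ) with hh
  have hhc : Continuous h := by
    have := Real.continuous_arccos
    fun_prop
  have e : ∀ s : ℝ, (∫ θ in (0 : ℝ)..Real.pi, Complex.exp (s * Complex.I * (r * Real.cos θ : ℝ)) *
        ((f (r * Real.cos θ) * (Real.sin θ * g θ) : ℝ) : ℂ)) =
      ∫ t, Real.fourierChar (-(t * (-s / (2 * Real.pi)))) • (Set.Ioc (-r) r).indicator h t := by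
    intro s
    have h1 := integral_deriv_smul_comp (a := 0) (b := Real.pi) (f := fun θ => r * Real.cos θ)
      (f' := fun θ => r * -Real.sin θ) (g := fun t => Complex.exp (s * Complex.I * (t : ℝ)) * h t)
      (fun θ _ => (Real.hasDerivAt_cos θ).const_mul r) (by fun_prop) (by fun_prop)
    rw [Real.cos_zero, Real.cos_pi, mul_one, mul_neg_one, intervalIntegral.integral_symm (-r) r,
      intervalIntegral.integral_of_le (by linarith : -r ≤ r), ← MeasureTheory.integral_indicator measurableSet_Ioc] at h1
    have h2 : ∀ t : ℝ, Real.fourierChar (-(t * (-s / (2 * Real.pi)))) •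
        (Set.Ioc (-r) r).indicator h t =
        (Set.Ioc (-r) r).indicator (fun t => Complex.exp (s * Complex.I * (t : ℝ)) * h t) t := by
      intro t
      rw [Circle.smul_def, Real.fourierChar_apply, smul_eq_mul, Set.indicator_apply,
        Set.indicator_apply, mul_ite, mul_zero]
      congr 3
      push_cast
      have : (Real.pi : ℂ) ≠ 0 := Complex.ofReal_ne_zero.mpr Real.pi_ne_zero
      field_simp
    simp only [h2]
    rw [← neg_eq_iff_eq_neg.mpr h1, ← intervalIntegral.integral_neg]
    refine intervalIntegral.integral_congr fun θ hθ => ?_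
    rw [Set.uIcc_of_le Real.pi_pos.le] at hθ
    have hcos : Real.arccos (r * Real.cos θ / r) = θ := by
      rw [mul_div_cancel_left₀ _ hr.ne', Real.arccos_cos hθ.1 hθ.2]
    simp only [hh, Function.comp_apply, hcos, Complex.real_smul]
    push_cast
    have : (r : ℂ) ≠ 0 := Complex.ofReal_ne_zero.mpr hr.ne'
    field_simp
  simp only [e]
  have hscale : Tendsto (fun s : ℝ => -s / (2 * Real.pi)) (cocompact ℝ) (cocompact ℝ) := by
    have hne : -(2 * Real.pi)⁻¹ ≠ 0 := by
      have := Real.pi_pos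
      exact neg_ne_zero.mpr (by positivity)
    convert! (Homeomorph.mulRight₀ _ hne).isClosedEmbedding.tendsto_cocompact using 2 with s
    simp [div_eq_mul_inv]
  exact (Real.tendsto_integral_exp_smul_cocompact ((Set.Ioc (-r) r).indicator h)).comp hscale

/-- The unitary group generated by the Laplacian tends weakly to zero on radial vectors. -/
lemma tendsto_inner_sphereVec_exp (hk : 2 ≤ k) (n : ℕ) :
    Tendsto (fun s : ℝ => (inner ℂ (sphereVec k n)
      (NormedSpace.exp ((s * Complex.I : ℂ) • freeLaplacian k) (deltaOne _)) : ℂ))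
      (cocompact ℝ) (𝓝 0) := by
  have hk' : (2 : ℝ) ≤ k := by exact_mod_cast hk
  have hr : √(2 * k - 1 : ℝ) ^ 2 = 2 * k - 1 := Real.sq_sqrt (by linarith)
  have hr0 : 1 < √(2 * k - 1 : ℝ) := by
    rw [Real.lt_sqrt zero_le_one]; linarith
  have hc := continuous_angularDensity (one_lt_pow₀ hr0 two_ne_zero)
  simp only [inner_sphereVec_exp hr hr0]
  simpa using (tendsto_integral_exp_cos (r := 2 * √(2 * k - 1 : ℝ)) (by positivity)
    (continuous_spherePoly k n) hc).const_mul (2 / Real.pi : ℂ)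

end OscillatoryDecay

/-! ### The multiplicative defect of `E` and its limit. -/

section AsymptoticHom

open FreeGroup

variable {k : ℕ}

variable (k) in
/-- The unitary group `s ↦ exp(i s w₁)` of the Laplacian. -/
def laplacianExp (s : ℝ) : EllTwo (FreeGroup (Fin k)) →L[ℂ] EllTwo (FreeGroup (Fin k)) :=
  NormedSpace.exp ((s * Complex.I : ℂ) • freeLaplacian k)

lemma laplacianExp_mem (s : ℝ) : laplacianExp k s ∈ laplacianAlgebra k :=
  mem_laplacianAlgebra_iff.mpr fun m hm =>
    (Commute.smul_right (show Commute m (freeLaplacian k) from hm.symm) _).exp_right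

lemma laplacianExp_add (s t : ℝ) :
    laplacianExp k (s + t) = laplacianExp k s * laplacianExp k t := by
  let _ : NormedAlgebra ℚ (EllTwo (FreeGroup (Fin k)) →L[ℂ] EllTwo (FreeGroup (Fin k))) :=
    NormedAlgebra.restrictScalars ℚ ℂ _
  rw [laplacianExp, Complex.ofReal_add, add_mul, add_smul]
  exact NormedSpace.exp_add_of_commute (((Commute.refl _).smul_left _).smul_right _)

lemma laplacianExp_zero : laplacianExp k 0 = 1 := by
  rw [laplacianExp, Complex.ofReal_zero, zero_mul, zero_smul, NormedSpace.exp_zero]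

lemma star_laplacianExp (s : ℝ) : star (laplacianExp k s) = laplacianExp k (-s) := by
  rw [laplacianExp, NormedSpace.star_exp, star_smul, star_freeLaplacian, laplacianExp]
  congr 2
  simp

lemma star_laplacianExp_mul (s : ℝ) : star (laplacianExp k s) * laplacianExp k s = 1 := by
  rw [star_laplacianExp, ← laplacianExp_add, neg_add_cancel, laplacianExp_zero]

lemma norm_laplacianExp_apply (s : ℝ) (f : EllTwo (FreeGroup (Fin k))) :
    ‖laplacianExp k s f‖ = ‖f‖ := by
  have h : inner ℂ (laplacianExp k s f) (laplacianExp k s f) = inner ℂ f f := by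
    rw [← ContinuousLinearMap.adjoint_inner_right, ← ContinuousLinearMap.star_eq_adjoint,
      ← mul_apply_eq_comp, star_laplacianExp_mul, one_apply_eq_self]
  rw [inner_self_eq_norm_sq_to_K, inner_self_eq_norm_sq_to_K] at h
  have h' : ‖laplacianExp k s f‖ ^ 2 = ‖f‖ ^ 2 := Complex.ofReal_injective (by simpa using h)
  exact (pow_left_inj₀ (norm_nonneg _) (norm_nonneg _) two_ne_zero).mp h'

lemma norm_laplacianExp_le (s : ℝ) : ‖laplacianExp k s‖ ≤ 1 :=
  ContinuousLinearMap.opNorm_le_bound _ zero_le_one fun f => by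
    rw [norm_laplacianExp_apply, one_mul]

variable (k) in
/-- `exp(i s w₁)` as a unitary of `VN(𝔽_k)`. -/
def laplacianUnitary (s : ℝ) : unitary (GroupVN (FreeGroup (Fin k))) :=
  ⟨⟨laplacianExp k s, laplacianAlgebra_le (laplacianExp_mem s)⟩, by
    rw [Unitary.mem_iff]
    refine ⟨Subtype.ext (star_laplacianExp_mul s), Subtype.ext ?_⟩
    change laplacianExp k s * star (laplacianExp k s) = 1
    rw [star_laplacianExp, ← laplacianExp_add, add_neg_cancel, laplacianExp_zero]⟩

lemma laplacianUnitary_add (s t : ℝ) :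
    laplacianUnitary k (s + t) = laplacianUnitary k s * laplacianUnitary k t :=
  Subtype.ext (Subtype.ext (laplacianExp_add s t))

lemma one_parameter_zpow {G : Type*} [Group G] (U : ℝ → G)
    (h : ∀ s t, U (s + t) = U s * U t) (n : ℤ) : U 1 ^ n = U n := by
  have := map_zpow (MonoidHom.mk' (M := Multiplicative ℝ) (fun s => U s.toAdd) fun s t => h _ _)
    (Multiplicative.ofAdd 1) n
  rw [← ofAdd_zsmul, zsmul_one] at this
  exact this.symm

lemma laplacianUnitary_one_zpow (n : ℤ) : laplacianUnitary k 1 ^ n = laplacianUnitary k n :=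
  one_parameter_zpow _ laplacianUnitary_add n

lemma tendsto_intCast_cocompact :
    Tendsto (fun n : ℤ => (n : ℝ)) (comap (fun n : ℤ => |n|) atTop) (cocompact ℝ) := by
  rw [← Metric.cobounded_eq_cocompact, ← tendsto_norm_atTop_iff_cobounded]
  have := (tendsto_intCast_atTop_atTop (R := ℝ)).comp
    (tendsto_comap (f := fun n : ℤ => |n|) (x := atTop))
  refine this.congr fun n => ?_
  simp

/-- `2`-norm bounded families of linear maps that tend to zero on the group elements tend to zero
everywhere on `VN(G)`. -/
lemma tendsto_of_tendsto_leftRegular {G ι : Type*} [Group G] {l : Filter ι}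
    (Φ : ι → GroupVN G →ₗ[ℂ] EllTwo G) {C : ℝ}
    (hC : ∀ i x, ‖Φ i x‖ ≤ C * ‖(x : EllTwo G →L[ℂ] EllTwo G) (deltaOne G)‖)
    (hg : ∀ g : G, Tendsto (fun i => Φ i ⟨leftRegular g, leftRegular_mem_groupVN g⟩) l (𝓝 0))
    (x : GroupVN G) : Tendsto (fun i => Φ i x) l (𝓝 0) := by
  have hspan : ∀ f ∈ Submodule.span ℂ (Set.range fun g : G => leftRegular g (deltaOne G)),
      ∃ y : GroupVN G, (y : EllTwo G →L[ℂ] EllTwo G) (deltaOne G) = f ∧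
        Tendsto (fun i => Φ i y) l (𝓝 0) := by
    intro f hf
    induction hf using Submodule.span_induction with
    | mem f hf =>
      obtain ⟨g, rfl⟩ := hf
      exact ⟨_, rfl, hg g⟩
    | zero => exact ⟨0, rfl, by simpa using tendsto_const_nhds⟩
    | add f₁ f₂ _ _ h₁ h₂ =>
      obtain ⟨y₁, e₁, t₁⟩ := h₁
      obtain ⟨y₂, e₂, t₂⟩ := h₂
      refine ⟨y₁ + y₂, ?_, by simpa using t₁.add t₂⟩
      rw [← e₁, ← e₂]
      rfl
    | smul c f _ h =>
      obtain ⟨y, e, t⟩ := h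
      refine ⟨c • y, ?_, by simpa using t.const_smul c⟩
      rw [← e]
      rfl
  rw [Metric.tendsto_nhds]
  intro ε hε
  have hd := Submodule.dense_iff_topologicalClosure_eq_top.mpr (dense_span_leftRegular (G := G))
  -- The `+ 1` keeps the denominator positive when `C = 0`.
  obtain ⟨f, hf, hxf⟩ := Metric.mem_closure_iff.mp
    (hd ((x : EllTwo G →L[ℂ] EllTwo G) (deltaOne G))) (ε / (2 * (|C| + 1))) (by positivity)
  obtain ⟨y, rfl, hy⟩ := hspan f hf
  filter_upwards [Metric.tendsto_nhds.mp hy (ε / 2) (by positivity)] with i hi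
  rw [dist_zero_right] at hi ⊢
  have h1 : ‖Φ i (x - y)‖ ≤ |C| * (ε / (2 * (|C| + 1))) := by
    refine (hC i (x - y)).trans (mul_le_mul (le_abs_self C) ?_ (norm_nonneg _) (abs_nonneg C))
    rw [dist_eq_norm] at hxf
    exact hxf.le
  have h2 : |C| * (ε / (2 * (|C| + 1))) ≤ ε / 2 := by
    rw [mul_div_assoc', div_le_div_iff₀ (by positivity) two_pos]
    nlinarith [abs_nonneg C]
  calc ‖Φ i x‖ = ‖Φ i (x - y) + Φ i y‖ := by rw [← map_add, sub_add_cancel]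
    _ ≤ ‖Φ i (x - y)‖ + ‖Φ i y‖ := norm_add_le _ _
    _ < ε := by linarith

variable {E : GroupVN (FreeGroup (Fin k)) →ₗ[ℂ] GroupVN (FreeGroup (Fin k))}

lemma IsTraceCondExp.leftRegular (hk : 2 ≤ k) (hE : IsTraceCondExp (laplacianAlgebra k) E)
    (g : FreeGroup (Fin k)) :
    (E ⟨leftRegular g, leftRegular_mem_groupVN g⟩ : EllTwo (FreeGroup (Fin k)) →L[ℂ] EllTwo (FreeGroup (Fin k))) =
      ((sphere (Fin k) g.norm).card : ℂ)⁻¹ • sphereOp k g.norm :=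
  eq_of_apply_deltaOne (E _).2 (smul_mem_groupVN _ (sphereOp_mem_groupVN _))
    ((hE.apply_deltaOne _).trans (deltaProj_leftRegular hk g))

lemma map_sub_mul_of_bimodule {R : Type*} [Ring R] [Algebra ℂ R] (E : R →ₗ[ℂ] R) {u x y : R}
    (h₁ : E (E x * u * y) = E x * u * E y) (h₂ : E y * u = u * E y) :
    E (x * u * y) - E x * E y * u = E ((x - E x) * (u * y)) := by
  rw [mul_assoc (E x), h₂, ← mul_assoc (E x), ← h₁, ← map_sub, sub_mul, mul_assoc, mul_assoc]

lemma IsTraceCondExp.defect_eq {G : Type*} [Group G] {N : VonNeumannAlgebra (EllTwo G)}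
    {E : GroupVN G →ₗ[ℂ] GroupVN G} (hE : IsTraceCondExp N E)
    (hab : ∀ a ∈ N, ∀ b ∈ N, a * b = b * a) (u x y : GroupVN G)
    (hu : (u : EllTwo G →L[ℂ] EllTwo G) ∈ N) :
    E (x * u * y) - E x * E y * u = E ((x - E x) * (u * y)) := by
  have h1 := hE.bimodule (E x * u) y 1 (mul_mem (hE.mem x) hu) (one_mem _)
  rw [mul_one, mul_one] at h1
  exact map_sub_mul_of_bimodule E h1 (Subtype.ext (hab _ (hE.mem y) _ hu))

/-- The defect of multiplicativity of `E`, evaluated at `δ_e`. -/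
def condExpDefect (E : GroupVN (FreeGroup (Fin k)) →ₗ[ℂ] GroupVN (FreeGroup (Fin k)))
    (s : ℝ) (x y : GroupVN (FreeGroup (Fin k))) : EllTwo (FreeGroup (Fin k)) :=
  ((E (x * (laplacianUnitary k s : GroupVN (FreeGroup (Fin k))) * y) -
    E x * E y * (laplacianUnitary k s : GroupVN (FreeGroup (Fin k))) :
      GroupVN (FreeGroup (Fin k))) : EllTwo (FreeGroup (Fin k)) →L[ℂ] EllTwo (FreeGroup (Fin k))) (deltaOne _)

lemma condExpDefect_eq (hE : IsTraceCondExp (laplacianAlgebra k) E) (s : ℝ)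
    (x y : GroupVN (FreeGroup (Fin k))) : condExpDefect E s x y =
      deltaProj (laplacianAlgebra k) (((x : EllTwo (FreeGroup (Fin k)) →L[ℂ] EllTwo (FreeGroup (Fin k))) - E x)
        (laplacianExp k s ((y : EllTwo (FreeGroup (Fin k)) →L[ℂ] EllTwo (FreeGroup (Fin k))) (deltaOne _)))) := by
  have h := hE.defect_eq laplacianAlgebra_comm (laplacianUnitary k s).val x y (laplacianExp_mem s)
  exact (congrArg (fun z : GroupVN (FreeGroup (Fin k)) =>
    (z : EllTwo (FreeGroup (Fin k)) →L[ℂ] EllTwo (FreeGroup (Fin k))) (deltaOne _)) h).trans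
    (hE.apply_deltaOne _)

/-- A 2-norm bound in `x`, uniform in `s`. The two terms are bounded separately; the trace property
lets the operator norms fall on the right-hand factors. -/
lemma norm_condExpDefect_le_left (hE : IsTraceCondExp (laplacianAlgebra k) E) (s : ℝ)
    (x y : GroupVN (FreeGroup (Fin k))) : ‖condExpDefect E s x y‖ ≤
      (‖(y : EllTwo (FreeGroup (Fin k)) →L[ℂ] EllTwo (FreeGroup (Fin k)))‖ + ‖(E y : EllTwo (FreeGroup (Fin k)) →L[ℂ] EllTwo (FreeGroup (Fin k)))‖) *
        ‖(x : EllTwo (FreeGroup (Fin k)) →L[ℂ] EllTwo (FreeGroup (Fin k))) (deltaOne _)‖ := by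
  have hu := laplacianAlgebra_le (laplacianExp_mem (k := k) s)
  have h1 : condExpDefect E s x y = deltaProj (laplacianAlgebra k)
      (((x : EllTwo (FreeGroup (Fin k)) →L[ℂ] EllTwo (FreeGroup (Fin k))) * laplacianExp k s)
        ((y : EllTwo (FreeGroup (Fin k)) →L[ℂ] EllTwo (FreeGroup (Fin k))) (deltaOne _))) -
      (E x : EllTwo (FreeGroup (Fin k)) →L[ℂ] EllTwo (FreeGroup (Fin k)))
        (((E y : EllTwo (FreeGroup (Fin k)) →L[ℂ] EllTwo (FreeGroup (Fin k))) * laplacianExp k s)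
          (deltaOne _)) :=
    congrArg (· - _) (hE.apply_deltaOne _)
  rw [h1, add_mul]
  refine (norm_sub_le _ _).trans (add_le_add ((norm_deltaProj_apply_le _).trans ?_) ?_)
  · refine (norm_mul_deltaOne_le (mul_mem x.2 hu) y.2).trans ?_
    rw [mul_comm]
    refine mul_le_mul_of_nonneg_left ?_ (norm_nonneg _)
    exact (norm_mul_deltaOne_le x.2 hu).trans
      (mul_le_of_le_one_right (norm_nonneg _) (norm_laplacianExp_le s))
  · refine (norm_mul_deltaOne_le (E x).2 (mul_mem (E y).2 hu)).trans ?_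
    rw [mul_comm]
    refine mul_le_mul ?_ ?_ (norm_nonneg _) (norm_nonneg _)
    · exact (_root_.norm_mul_le _ _).trans
        (mul_le_of_le_one_right (norm_nonneg _) (norm_laplacianExp_le s))
    · rw [hE.apply_deltaOne]
      exact norm_deltaProj_apply_le _

lemma norm_condExpDefect_le_right (hE : IsTraceCondExp (laplacianAlgebra k) E) (s : ℝ)
    (x y : GroupVN (FreeGroup (Fin k))) : ‖condExpDefect E s x y‖ ≤
      ‖(x : EllTwo (FreeGroup (Fin k)) →L[ℂ] EllTwo (FreeGroup (Fin k))) - E x‖ *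
        ‖(y : EllTwo (FreeGroup (Fin k)) →L[ℂ] EllTwo (FreeGroup (Fin k))) (deltaOne _)‖ := by
  rw [condExpDefect_eq hE]
  refine (norm_deltaProj_apply_le _).trans ((ContinuousLinearMap.le_opNorm _ _).trans ?_)
  rw [norm_laplacianExp_apply]

lemma tendsto_condExpDefect_leftRegular (hk : 2 ≤ k)
    (hE : IsTraceCondExp (laplacianAlgebra k) E) (g h : FreeGroup (Fin k)) :
    Tendsto (fun s => condExpDefect E s ⟨leftRegular g, leftRegular_mem_groupVN g⟩
      ⟨leftRegular h, leftRegular_mem_groupVN h⟩) (cocompact ℝ) (𝓝 0) := by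
  obtain ⟨C, hC⟩ := exists_norm_deltaProj_sub_average_le hk g h
  let T : EllTwo (FreeGroup (Fin k)) →L[ℂ] EllTwo (FreeGroup (Fin k)) :=
    deltaProj (laplacianAlgebra k) *
      (leftRegular g - ((sphere (Fin k) g.norm).card : ℂ)⁻¹ • sphereOp k g.norm) *
      rightRegular h⁻¹
  have key := tendsto_apply_of_radial hk (l := cocompact ℝ)
    (ξ := fun s => laplacianExp k s (deltaOne _)) (fun s => apply_deltaOne_mem (laplacianExp_mem s))
    (fun s => by
      rw [norm_laplacianExp_apply, ← sphereVec_zero, norm_sphereVec, card_sphere_zero]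
      simp) (tendsto_inner_sphereVec_exp hk) T (C := C) hC
  refine key.congr fun s => ?_
  rw [condExpDefect_eq hE, hE.leftRegular hk]
  simp only [T, mul_apply_eq_comp]
  -- `λ(h) δ_e = ρ(h⁻¹) δ_e`, and `ρ(h⁻¹)` commutes with the exponential, so the defect is a fixed
  -- operator applied to a radial vector.
  rw [rightRegular_apply_comm (laplacianAlgebra_le (laplacianExp_mem s)), rightRegular_deltaOne,
    inv_inv]

lemma tendsto_condExpDefect (hk : 2 ≤ k) (hE : IsTraceCondExp (laplacianAlgebra k) E)
    (x y : GroupVN (FreeGroup (Fin k))) :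
    Tendsto (fun s => condExpDefect E s x y) (cocompact ℝ) (𝓝 0) := by
  let ev : GroupVN (FreeGroup (Fin k)) →ₗ[ℂ] EllTwo (FreeGroup (Fin k)) :=
    (ContinuousLinearMap.apply ℂ _ (deltaOne _)).toLinearMap.comp
      (groupVN (FreeGroup (Fin k))).toStarSubalgebra.toSubalgebra.toSubmodule.subtype
  -- Each 2-norm bound involves an operator norm in the other variable. So `x` is made general with
  -- `y = λ(h)` fixed, and then `y` with `x` fixed.
  have hleft : ∀ h x, Tendsto (fun s => condExpDefect E s x
      ⟨leftRegular h, leftRegular_mem_groupVN h⟩) (cocompact ℝ) (𝓝 0) := fun h x => by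
    let z : GroupVN (FreeGroup (Fin k)) := ⟨leftRegular h, leftRegular_mem_groupVN h⟩
    let Φ : ℝ → GroupVN (FreeGroup (Fin k)) →ₗ[ℂ] EllTwo (FreeGroup (Fin k)) := fun s =>
      ev ∘ₗ (E ∘ₗ LinearMap.mulRight ℂ z ∘ₗ LinearMap.mulRight ℂ
        (laplacianUnitary k s : GroupVN (FreeGroup (Fin k))) - LinearMap.mulRight ℂ
        (laplacianUnitary k s : GroupVN (FreeGroup (Fin k))) ∘ₗ LinearMap.mulRight ℂ (E z) ∘ₗ E)
    exact tendsto_of_tendsto_leftRegular Φ (fun s x => norm_condExpDefect_le_left hE s x z)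
      (fun g => tendsto_condExpDefect_leftRegular hk hE g h) x
  let Φ : ℝ → GroupVN (FreeGroup (Fin k)) →ₗ[ℂ] EllTwo (FreeGroup (Fin k)) := fun s =>
    ev ∘ₗ (E ∘ₗ LinearMap.mulLeft ℂ (x * (laplacianUnitary k s : GroupVN (FreeGroup (Fin k)))) -
      LinearMap.mulRight ℂ (laplacianUnitary k s : GroupVN (FreeGroup (Fin k))) ∘ₗ
        LinearMap.mulLeft ℂ (E x) ∘ₗ E)
  exact tendsto_of_tendsto_leftRegular Φ (fun s y => norm_condExpDefect_le_right hE s x y)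
    (fun h => hleft h x) y

end AsymptoticHom

end

theorem theorem5p1 (k : ℕ) (hk : 2 ≤ k) :
    (∃! E : GroupVN (FreeGroup (Fin k)) →ₗ[ℂ] GroupVN (FreeGroup (Fin k)),
      IsTraceCondExp (laplacianAlgebra k) E) ∧
    ∀ E : GroupVN (FreeGroup (Fin k)) →ₗ[ℂ] GroupVN (FreeGroup (Fin k)),
      IsTraceCondExp (laplacianAlgebra k) E → IsAsymptoticHom (laplacianAlgebra k) E := by
  constructor
  · obtain ⟨E, hE⟩ := exists_isTraceCondExp (laplacianAlgebra_le (k := k)) laplacianAlgebra_comm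
    exact ⟨E, hE, fun F hF => hF.unique hE⟩
  · intro E hE
    refine ⟨laplacianAlgebra_comm, laplacianUnitary k 1, laplacianExp_mem 1, fun x y => ?_⟩
    -- Integer powers of `u` are the values of the one-parameter group at integers, so the limit
    -- over real `s` restricts to them.
    simp only [laplacianUnitary_one_zpow, normTwo_eq]
    exact (tendsto_zero_iff_norm_tendsto_zero.mp (tendsto_condExpDefect hk hE x y)).comp
      tendsto_intCast_cocompact
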